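/- All manifolds are smooth, Hausdorff, second countable and without boundary, of finite dimension $n$. A manifold is called open if none of its connected components is compact. Let $(M,g)$ be a Riemannian manifold, let $\Delta_g$ be its Laplace--Beltrami operator, and let $D$ be the Levi-Civita connection of a metric under consideration. For a smooth function $\varphi: M \to \mathbb{R}$ and $h>0$ put $P_{0,\varphi} = e^{\varphi/h}(-h^2\Delta_g)e^{-\varphi/h}$, and let $p_\varphi : T^*M \to \mathbb{C}$ be the semiclassical principal symbol of $P_{0,\varphi}$ (explicitly, $p_\varphi(x,\xi) = |\xi|^2 - |d\varphi|^2 + 2i\langle \xi, d\varphi\rangle$). The function $\varphi$ is called a limiting Carleman weight on $(M,g)$ if $d\varphi$ vanishes nowhere and the Poisson bracket on $T^*M$ satisfies $$\{\overline{p_\varphi}, p_\varphi\} = 0 \quad \text{at every point of } T^*M \text{ where } p_\varphi = 0 .$$ Theorem. (1) If $(M,g)$ is open and has a limiting Carleman weight, then there are a smooth positive function $c$ on $M$ and a smooth vector field $X$ on $M$ such that $X$ is a parallel unit vector field for the metric $cg$, that is, $(cg)(X,X)=1$ everywhere and $DX = 0$ for the Levi-Civita connection $D$ of $cg$. (2)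 Conversely, if $M$ is simply connected (in particular connected and non-empty) and there are a smooth positive function $c$ and a smooth vector field $X$ on $M$ such that $X$ is a parallel unit vector field for $cg$, then $(M,g)$ has a limiting Carleman weight. -/

import Mathlib

open Bundle Filter Topology
open scoped Manifold ContDiff ComplexConjugate

/-- The coordinate space `ℝⁿ`; it is used for positions `y` and for momenta `ξ`. -/
abbrev Coord (n : ℕ) : Type := EuclideanSpace ℝ (Fin n)

/-- The `j`-th standard basis vector of `ℝⁿ`. -/
noncomputable def stdVec {n : ℕ} (j : Fin n) : Coord n := EuclideanSpace.single j (1 : ℝ)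

/-- The partial derivative `∂_j f` at `y`. -/
noncomputable def pderiv {n : ℕ} {F : Type*} [NormedAddCommGroup F] [NormedSpace ℝ F]
    (j : Fin n) (f : Coord n → F) (y : Coord n) : F :=
  fderiv ℝ f y (stdVec j)

/-- The Poisson bracket `{a, b} = ∑ⱼ (∂a/∂ξⱼ ∂b/∂xⱼ - ∂a/∂xⱼ ∂b/∂ξⱼ)` of complex functions of
canonical coordinates `(x, ξ)`. -/
noncomputable def poissonBracket {n : ℕ} (a b : Coord n × Coord n → ℂ)
    (z : Coord n × Coord n) : ℂ :=
  ∑ j : Fin n,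
    (fderiv ℝ a z (0, stdVec j) * fderiv ℝ b z (stdVec j, 0)
      - fderiv ℝ a z (stdVec j, 0) * fderiv ℝ b z (0, stdVec j))

/-- `p` is the semiclassical principal symbol over `U ⊆ ℝⁿ` of the family `P h`, `h > 0`, of
differential operators: for each covector `ξ`,
`e^{-i⟨y,ξ⟩/h} P_h (e^{i⟨·,ξ⟩/h})(y) → p(y, ξ)` as `h → 0+`.
(For `P_h = ∑_α a_α(y; h) (h D)^α` with `a_α(y; h) = a_α(y) + O(h)` this is
`p(y, ξ) = ∑_α a_α(y) ξ^α`, which is also the leading part of the Weyl symbol.) -/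
def IsPrincipalSymbol {n : ℕ} (P : ℝ → (Coord n → ℂ) → Coord n → ℂ) (U : Set (Coord n))
    (p : Coord n × Coord n → ℂ) : Prop :=
  ∀ y ∈ U, ∀ ξ : Coord n,
    Tendsto
      (fun h : ℝ ↦ Complex.exp (-(Complex.I * ((∑ j, y j * ξ j : ℝ) : ℂ)) / (h : ℂ))
        * P h (fun z ↦ Complex.exp (Complex.I * ((∑ j, z j * ξ j : ℝ) : ℂ) / (h : ℂ))) y)
      (𝓝[>] 0) (𝓝 (p (y, ξ)))

/-- No connected component of the space is compact. (A manifold modelled on `ℝⁿ` has no boundary,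
so this says that it is an open manifold.) -/
def IsOpenManifold (M : Type*) [TopologicalSpace M] : Prop :=
  ∀ x : M, ¬ IsCompact (connectedComponent x)

/-- Smooth Riemannian metrics on the `n`-dimensional smooth manifold `M`. -/
abbrev RiemMetric (n : ℕ) (M : Type*) [TopologicalSpace M] [ChartedSpace (Coord n) M]
    [IsManifold (𝓡 n) ∞ M] : Type _ :=
  ContMDiffRiemannianMetric (𝓡 n) ∞ (Coord n) (fun x : M ↦ TangentSpace (𝓡 n) x)

section Riemannian

variable {n : ℕ} {M : Type*} [TopologicalSpace M] [ChartedSpace (Coord n) M]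

/-- The coordinate vector field `∂_j` of the chart `e`, at the point with coordinates `y`. -/
noncomputable def coordVec (e : OpenPartialHomeomorph M (Coord n)) (j : Fin n) (y : Coord n) :
    TangentSpace (𝓡 n) (e.symm y) :=
  mfderiv (𝓡 n) (𝓡 n) e.symm y (stdVec j : Coord n)

/-- The `k`-th component `X^k = dx^k(X)` in the chart `e` of the vector field `X`, as a function
of the coordinates `y`. -/
noncomputable def component (e : OpenPartialHomeomorph M (Coord n))
    (X : (x : M) → TangentSpace (𝓡 n) x) (k : Fin n) (y : Coord n) : ℝ :=
  (EuclideanSpace.proj k : Coord n →L[ℝ] ℝ) (mfderiv (𝓡 n) (𝓡 n) e (e.symm y) (X (e.symm y)))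

variable [IsManifold (𝓡 n) ∞ M]

/-- The matrix `(g_{jk})` of the metric in the chart `e`, as a function of the coordinates. -/
noncomputable def metricMatrix (g : RiemMetric n M) (e : OpenPartialHomeomorph M (Coord n))
    (y : Coord n) : Matrix (Fin n) (Fin n) ℝ :=
  Matrix.of fun j k ↦ g.inner (e.symm y) (coordVec e j y) (coordVec e k y)

/-- The Christoffel symbols
`Γ^l_{jk} = ½ g^{lm} (∂_j g_{km} + ∂_k g_{jm} - ∂_m g_{jk})` in the chart `e`. -/
noncomputable def christoffel (g : RiemMetric n M) (e : OpenPartialHomeomorph M (Coord n))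
    (l j k : Fin n) (y : Coord n) : ℝ :=
  (1 / 2) * ∑ m, (metricMatrix g e y)⁻¹ l m *
    (pderiv j (fun z ↦ metricMatrix g e z k m) y
      + pderiv k (fun z ↦ metricMatrix g e z j m) y
      - pderiv m (fun z ↦ metricMatrix g e z j k) y)

/-- The component `(D_{∂_j} X)^l = ∂_j X^l + Γ^l_{jk} X^k` in the chart `e` of the covariant
derivative of `X` for the Levi-Civita connection of `g`. -/
noncomputable def covDeriv (g : RiemMetric n M) (e : OpenPartialHomeomorph M (Coord n))
    (X : (x : M) → TangentSpace (𝓡 n) x) (j l : Fin n) (y : Coord n) : ℝ :=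
  pderiv j (component e X l) y + ∑ k, christoffel g e l j k y * component e X k y

/-- The smooth vector field `X` is a parallel unit vector field for `g`: `|X| = 1` and `DX = 0`
(all components of `DX` vanish in every smooth chart). -/
structure IsParallelUnitField (g : RiemMetric n M) (X : (x : M) → TangentSpace (𝓡 n) x) : Prop where
  smooth : ContMDiff (𝓡 n) (𝓡 n).tangent ∞ (fun x ↦ (⟨x, X x⟩ : TangentBundle (𝓡 n) M))
  unit : ∀ x, g.inner x (X x) (X x) = 1
  parallel : ∀ e ∈ IsManifold.maximalAtlas (𝓡 n) ∞ M, ∀ y ∈ e.target, ∀ j l : Fin n,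
    covDeriv g e X j l y = 0

/-- `g₁ = c g` for some smooth positive function `c`. -/
def IsConformalMultiple (g₁ g : RiemMetric n M) : Prop :=
  ∃ c : M → ℝ, ContMDiff (𝓡 n) 𝓘(ℝ, ℝ) ∞ c ∧ (∀ x, 0 < c x) ∧
    ∀ (x : M) (v w : TangentSpace (𝓡 n) x), g₁.inner x v w = c x * g.inner x v w

/-- The Laplace-Beltrami operator `Δ_g u = |g|^{-1/2} ∂_j (|g|^{1/2} g^{jk} ∂_k u)` in the
coordinates of the chart `e`. -/
noncomputable def laplaceBeltrami (g : RiemMetric n M) (e : OpenPartialHomeomorph M (Coord n))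
    (u : Coord n → ℂ) (y : Coord n) : ℂ :=
  (((√(metricMatrix g e y).det)⁻¹ : ℝ) : ℂ) *
    ∑ j, ∑ k, pderiv j (fun z ↦
      ((√(metricMatrix g e z).det * (metricMatrix g e z)⁻¹ j k : ℝ) : ℂ) * pderiv k u z) y

/-- The conjugated semiclassical Laplace-Beltrami operator `e^{φ/h} (-h² Δ_g) e^{-φ/h}` in the
coordinates of the chart `e`. -/
noncomputable def conjugatedOperator (g : RiemMetric n M) (e : OpenPartialHomeomorph M (Coord n))
    (φ : M → ℝ) (h : ℝ) (u : Coord n → ℂ) (y : Coord n) : ℂ :=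
  Complex.exp ((φ (e.symm y) / h : ℝ) : ℂ) *
    (-(h : ℂ) ^ 2 *
      laplaceBeltrami g e (fun z ↦ Complex.exp ((-(φ (e.symm z)) / h : ℝ) : ℂ) * u z) y)

/-- `φ` is a limiting Carleman weight for `g`: it is smooth and real valued, its differential
vanishes nowhere, and the principal symbol `p` of the conjugated Laplace-Beltrami operator
satisfies `{p̄, p} = 0` on the part of the cotangent bundle where `p = 0` (written in the
canonical coordinates of the cotangent bundle over each smooth chart). -/
structure IsLimitingCarlemanWeight (g : RiemMetric n M) (φ : M → ℝ) : Prop where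
  smooth : ContMDiff (𝓡 n) 𝓘(ℝ, ℝ) ∞ φ
  nonvanishing : ∀ x, mfderiv (𝓡 n) 𝓘(ℝ, ℝ) φ x ≠ 0
  bracket : ∀ e ∈ IsManifold.maximalAtlas (𝓡 n) ∞ M, ∃ p : Coord n × Coord n → ℂ,
    IsPrincipalSymbol (conjugatedOperator g e φ) e.target p ∧
    ∀ y ∈ e.target, ∀ ξ : Coord n, p (y, ξ) = 0 →
      poissonBracket (fun z ↦ conj (p z)) p (y, ξ) = 0

end Riemannian

/-! The principal symbol is `p = |ξ + i dφ|²_g`. Let `v` be the vector dual to `ξ` and `X = grad φ`.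
A computation in coordinates gives, at every covector, `{p̄, p} = 8i (Hess φ(v, v) + Hess φ(X, X))`
(`poissonBracket_weightSymbol`), and `p = 0` means `|v| = |X|` and `v ⊥ X`. Passing from `g` to `cg`
divides `p` by `c`; on the zero set this only rescales the bracket by a nonzero factor, so the
bracket condition is conformally invariant (`bracket_condition_smul_iff`).

Given a weight `φ`, choose `c = |dφ|²_g`, so that `|dφ| = 1` for `cg`. Differentiating this identity
gives `Hess φ(X, ·) = 0`. The bracket condition then says `Hess φ(v, v) = 0` for unit `v ⊥ X`;
homogeneity, the splitting along `X` and polarization give `Hess φ = 0`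
(`hessianComponent_eq_zero`). As `Hess φ` is `DX` with an index lowered, `X` is a parallel unit
field.

Conversely, the 1-form dual to a parallel field is closed, because the Levi-Civita connection is
torsion free. On a simply connected manifold it is therefore `dφ` for some `φ`
(`exists_primitive_of_closed`, by lifting through the covering space of local primitives). Then
`|dφ| = 1` and `Hess φ = 0` for `cg`, so the bracket condition holds for `cg`, and hence for `g`. -/

/-! ### Pointwise algebra of the bracket and the Hessian -/

section Calculus

variable {n : ℕ}

/-- The Hessian `∂_j∂_m f - Γ^k_{jm} ∂_k f` of `f`, where `X` is the gradient of `f` and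
`dG j k l = ∂_j G_{kl}`. -/
noncomputable def hessianForm (dG : Fin n → Fin n → Fin n → ℝ) (ddf : Fin n → Fin n → ℝ)
    (X : Fin n → ℝ) (j m : Fin n) : ℝ :=
  ddf j m - (1 / 2) * ∑ k, (dG j m k + dG m j k - dG k j m) * X k

/-- The three Christoffel terms are one trilinear sum in `dG` with its arguments permuted. In this
form the values at `(v, v)` and `(X, X)` can be compared with the bracket. -/
lemma sum_hessianForm_mul_mul (dG : Fin n → Fin n → Fin n → ℝ)
    (ddf : Fin n → Fin n → ℝ) (X u w : Fin n → ℝ) :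
    ∑ j, ∑ m, hessianForm dG ddf X j m * u j * w m
      = ∑ j, ∑ m, ddf j m * u j * w m
        - (1 / 2) * (∑ j, ∑ k, ∑ l, dG j k l * u j * w k * X l
          + ∑ j, ∑ k, ∑ l, dG j k l * w j * u k * X l
          - ∑ j, ∑ k, ∑ l, dG j k l * X j * u k * w l) := by
  have h2 : ∑ j, ∑ k, ∑ l, dG j k l * w j * u k * X l
      = ∑ j, ∑ k, ∑ l, dG k j l * w k * u j * X l := Finset.sum_comm
  have h3 : ∑ j, ∑ k, ∑ l, dG j k l * X j * u k * w l
      = ∑ j, ∑ k, ∑ l, dG l j k * X l * u j * w k := by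
    rw [Finset.sum_comm]
    refine Finset.sum_congr rfl fun j _ ↦ ?_
    rw [Finset.sum_comm]
  rw [h2, h3]
  simp only [Finset.mul_sum, ← Finset.sum_add_distrib, ← Finset.sum_sub_distrib, hessianForm,
    Finset.sum_mul, sub_mul]
  refine Finset.sum_congr rfl fun j _ ↦ Finset.sum_congr rfl fun k _ ↦ ?_
  congr 1
  refine Finset.sum_congr rfl fun l _ ↦ ?_
  ring

/-- Here `A` and `P` stand for the `ξ`- and `x`-derivatives of the symbol, and `v + iX` for the
raised complex covector `ξ + i df`. Each summand is `2i` times the imaginary part of `conj (A j) * P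
j`; its terms cubic in `v` and `X` are exactly the Christoffel terms of the two Hessian values. -/
lemma bracket_eq_hessianForm (dG : Fin n → Fin n → Fin n → ℝ) (hdG : ∀ j k l, dG j k l = dG j l k)
    (ddf : Fin n → Fin n → ℝ) (v X : Fin n → ℝ) (A P : Fin n → ℂ)
    (hA : ∀ j, A j = 2 * (v j + Complex.I * X j))
    (hP : ∀ j, P j = -(∑ k, ∑ l, (dG j k l : ℂ) * (v k + Complex.I * X k) * (v l + Complex.I * X l))
      + 2 * Complex.I * ∑ k, (v k + Complex.I * X k) * ddf j k) :
    ∑ j, (conj (A j) * P j - conj (P j) * A j)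
      = 8 * Complex.I * ((∑ j, ∑ m, hessianForm dG ddf X j m * v j * v m
        + ∑ j, ∑ m, hessianForm dG ddf X j m * X j * X m : ℝ) : ℂ) := by
  have hquad : ∀ j, ∑ k, ∑ l, (dG j k l : ℂ) * (v k + Complex.I * X k) * (v l + Complex.I * X l)
      = ((∑ k, ∑ l, dG j k l * (v k * v l) - ∑ k, ∑ l, dG j k l * (X k * X l) : ℝ) : ℂ)
        + Complex.I * ((2 * ∑ k, ∑ l, dG j k l * (v k * X l) : ℝ) : ℂ) := by
    intro j
    have hswap : ∑ k, ∑ l, dG j k l * (X k * v l) = ∑ k, ∑ l, dG j k l * (v k * X l) := by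
      rw [Finset.sum_comm]
      refine Finset.sum_congr rfl fun k _ ↦ Finset.sum_congr rfl fun l _ ↦ ?_
      rw [hdG]
      ring
    rw [two_mul]
    nth_rewrite 1 [← hswap]
    push_cast
    simp only [Finset.mul_sum, ← Finset.sum_add_distrib, ← Finset.sum_sub_distrib]
    refine Finset.sum_congr rfl fun k _ ↦ Finset.sum_congr rfl fun l _ ↦ ?_
    linear_combination (dG j k l : ℂ) * X k * X l * Complex.I_sq
  have hlin : ∀ j, ∑ k, (v k + Complex.I * X k) * (ddf j k : ℂ)
      = ((∑ k, v k * ddf j k : ℝ) : ℂ) + Complex.I * ((∑ k, X k * ddf j k : ℝ) : ℂ) := by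
    intro j
    push_cast
    simp only [Finset.mul_sum, ← Finset.sum_add_distrib]
    exact Finset.sum_congr rfl fun k _ ↦ by ring
  have hre : ∀ j, (P j).re = -(∑ k, ∑ l, dG j k l * (v k * v l)
      - ∑ k, ∑ l, dG j k l * (X k * X l)) - 2 * ∑ k, X k * ddf j k := by
    intro j
    rw [hP, hquad, hlin]
    simp
    ring
  have him : ∀ j, (P j).im = -2 * (∑ k, ∑ l, dG j k l * (v k * X l))
      + 2 * ∑ k, v k * ddf j k := by
    intro j
    rw [hP, hquad, hlin]
    simp
  have hterm : ∀ j, conj (A j) * P j - conj (P j) * A j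
      = ((4 * (v j * (P j).im - X j * (P j).re) : ℝ) : ℂ) * Complex.I := by
    intro j
    rw [hA]
    apply Complex.ext <;> simp <;> ring
  simp only [hterm, ← Finset.sum_mul, ← Complex.ofReal_sum]
  rw [mul_comm (8 : ℂ), mul_assoc, mul_comm]
  congr 1
  rw [show (8 : ℂ) = ((8 : ℝ) : ℂ) by norm_num, ← Complex.ofReal_mul]
  congr 1
  simp only [sum_hessianForm_mul_mul, hre, him]
  have e1 : ∑ j, ∑ k, ∑ l, dG j k l * v j * v k * X l = ∑ j, v j * ∑ k, ∑ l, dG j k l * (v k * X l) := by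
    simp only [Finset.mul_sum]
    refine Finset.sum_congr rfl fun j _ ↦ Finset.sum_congr rfl fun k _ ↦
      Finset.sum_congr rfl fun l _ ↦ by ring
  have e2 : ∑ j, ∑ k, ∑ l, dG j k l * X j * v k * v l = ∑ j, X j * ∑ k, ∑ l, dG j k l * (v k * v l) := by
    simp only [Finset.mul_sum]
    refine Finset.sum_congr rfl fun j _ ↦ Finset.sum_congr rfl fun k _ ↦
      Finset.sum_congr rfl fun l _ ↦ by ring
  have e3 : ∑ j, ∑ k, ∑ l, dG j k l * X j * X k * X l = ∑ j, X j * ∑ k, ∑ l, dG j k l * (X k * X l) := by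
    simp only [Finset.mul_sum]
    refine Finset.sum_congr rfl fun j _ ↦ Finset.sum_congr rfl fun k _ ↦
      Finset.sum_congr rfl fun l _ ↦ by ring
  have e4 : ∀ w : Fin n → ℝ, ∑ j, ∑ m, ddf j m * w j * w m = ∑ j, w j * ∑ m, w m * ddf j m := by
    intro w
    simp only [Finset.mul_sum]
    refine Finset.sum_congr rfl fun j _ ↦ Finset.sum_congr rfl fun k _ ↦ by ring
  rw [e1, e2, e3, e4, e4]
  simp only [mul_add, mul_sub, Finset.sum_add_distrib, Finset.sum_sub_distrib, mul_neg,
    mul_left_comm _ (2 : ℝ), ← Finset.mul_sum, mul_left_comm _ (-2 : ℝ), Finset.sum_neg_distrib]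
  ring

end Calculus

/-! ### Metrics on open subsets of `ℝⁿ` -/

section Calculus

variable {n : ℕ}

/-- A smooth Riemannian metric on an open subset of `ℝⁿ`, given by its matrix. -/
structure IsSmoothMetricOn (G : Coord n → Matrix (Fin n) (Fin n) ℝ) (U : Set (Coord n)) : Prop where
  isOpen : IsOpen U
  smooth : ∀ j k, ContDiffOn ℝ ∞ (fun y ↦ G y j k) U
  posDef : ∀ y ∈ U, (G y).PosDef

namespace IsSmoothMetricOn

variable {G : Coord n → Matrix (Fin n) (Fin n) ℝ} {U : Set (Coord n)} {y : Coord n}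

lemma det_pos (hG : IsSmoothMetricOn G U) (hy : y ∈ U) : 0 < (G y).det := (hG.posDef y hy).det_pos

lemma symm (hG : IsSmoothMetricOn G U) (hy : y ∈ U) (j k : Fin n) : G y j k = G y k j := by
  have := (hG.posDef y hy).isHermitian.apply k j
  simpa using this

lemma inv_symm (hG : IsSmoothMetricOn G U) (hy : y ∈ U) (j k : Fin n) :
    (G y)⁻¹ j k = (G y)⁻¹ k j := by
  have := (hG.posDef y hy).inv.isHermitian.apply k j
  simpa using this

lemma mul_inv (hG : IsSmoothMetricOn G U) (hy : y ∈ U) : G y * (G y)⁻¹ = 1 :=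
  Matrix.mul_nonsing_inv _ (hG.det_pos hy).ne'.isUnit

lemma inv_mul (hG : IsSmoothMetricOn G U) (hy : y ∈ U) : (G y)⁻¹ * G y = 1 :=
  Matrix.nonsing_inv_mul _ (hG.det_pos hy).ne'.isUnit

end IsSmoothMetricOn

lemma contDiffOn_det {ι E : Type*} [Fintype ι] [DecidableEq ι] [NormedAddCommGroup E]
    [NormedSpace ℝ E] {r : WithTop ℕ∞} {U : Set E}
    {G : E → Matrix ι ι ℝ} (hG : ∀ j k, ContDiffOn ℝ r (fun y ↦ G y j k) U) :
    ContDiffOn ℝ r (fun y ↦ (G y).det) U := by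
  simp only [Matrix.det_apply']
  exact ContDiffOn.sum fun σ _ ↦ contDiffOn_const.mul (contDiffOn_prod fun i _ ↦ hG _ _)

namespace IsSmoothMetricOn

variable {G : Coord n → Matrix (Fin n) (Fin n) ℝ} {U : Set (Coord n)} {y : Coord n}

lemma det_smooth (hG : IsSmoothMetricOn G U) : ContDiffOn ℝ ∞ (fun y ↦ (G y).det) U :=
  contDiffOn_det hG.smooth

lemma sqrt_det_smooth (hG : IsSmoothMetricOn G U) : ContDiffOn ℝ ∞ (fun y ↦ √(G y).det) U :=
  hG.det_smooth.sqrt fun _ hy ↦ (hG.det_pos hy).ne'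

lemma inv_smooth (hG : IsSmoothMetricOn G U) (j k : Fin n) :
    ContDiffOn ℝ ∞ (fun y ↦ (G y)⁻¹ j k) U := by
  -- By Cramer's rule the entries of the inverse are determinants divided by `det G`.
  simp only [Matrix.inv_def, Ring.inverse_eq_inv', Matrix.smul_apply, smul_eq_mul,
    Matrix.adjugate_apply]
  refine (hG.det_smooth.inv fun _ hy ↦ (hG.det_pos hy).ne').mul (contDiffOn_det fun a b ↦ ?_)
  by_cases h : a = k
  · subst h
    simpa using contDiffOn_const
  · simpa [Matrix.updateRow_apply, h] using hG.smooth a b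

lemma conformal (hG : IsSmoothMetricOn G U) {c : Coord n → ℝ} (hc : ContDiffOn ℝ ∞ c U)
    (hpos : ∀ y ∈ U, 0 < c y) : IsSmoothMetricOn (fun y ↦ c y • G y) U where
  isOpen := hG.isOpen
  smooth j k := hc.mul (hG.smooth j k)
  posDef y hy := (hG.posDef y hy).smul (hpos y hy)

lemma differentiableAt (hG : IsSmoothMetricOn G U) (hy : y ∈ U) (j k : Fin n) :
    DifferentiableAt ℝ (fun y ↦ G y j k) y :=
  ((hG.smooth j k).contDiffAt (hG.isOpen.mem_nhds hy)).differentiableAt (by simp)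

lemma inv_differentiableAt (hG : IsSmoothMetricOn G U) (hy : y ∈ U) (j k : Fin n) :
    DifferentiableAt ℝ (fun y ↦ (G y)⁻¹ j k) y :=
  ((hG.inv_smooth j k).contDiffAt (hG.isOpen.mem_nhds hy)).differentiableAt (by simp)

/-- The derivative of the inverse matrix is `dG⁻¹ = -G⁻¹ dG G⁻¹`. -/
lemma fderiv_inv (hG : IsSmoothMetricOn G U) (hy : y ∈ U) (u : Coord n) :
    Matrix.of (fun j k ↦ fderiv ℝ (fun y ↦ (G y)⁻¹ j k) y u)
      = -((G y)⁻¹ * Matrix.of (fun j k ↦ fderiv ℝ (fun y ↦ G y j k) y u) * (G y)⁻¹) := by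
  -- Differentiate `G G⁻¹ = 1`, then multiply by `G⁻¹` from the left.
  have h1 : Matrix.of (fun j k ↦ fderiv ℝ (fun y ↦ G y j k) y u) * (G y)⁻¹
      + G y * Matrix.of (fun j k ↦ fderiv ℝ (fun y ↦ (G y)⁻¹ j k) y u) = 0 := by
    ext j k
    have hconst : (fun z ↦ ∑ l, G z j l * (G z)⁻¹ l k) =ᶠ[𝓝 y]
        fun _ ↦ (1 : Matrix (Fin n) (Fin n) ℝ) j k := by
      filter_upwards [hG.isOpen.mem_nhds hy] with z hz
      rw [← hG.mul_inv hz, Matrix.mul_apply]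
    have hder := HasFDerivAt.fun_sum (u := Finset.univ) fun l _ ↦
      (hG.differentiableAt hy j l).hasFDerivAt.mul (hG.inv_differentiableAt hy l k).hasFDerivAt
    have h0 := hder.unique ((hasFDerivAt_const _ y).congr_of_eventuallyEq hconst)
    have h0 := congr($h0 u)
    simp [Finset.sum_add_distrib] at h0
    simp [Matrix.mul_apply]
    rw [← h0, add_comm]
    simp [mul_comm]
  have h2 := congr((G y)⁻¹ * $h1)
  rw [mul_add, ← mul_assoc, ← mul_assoc, hG.inv_mul hy, one_mul, mul_zero] at h2
  exact eq_neg_of_add_eq_zero_right h2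

end IsSmoothMetricOn

lemma ContDiffOn.pderiv {F : Type*} [NormedAddCommGroup F] [NormedSpace ℝ F] {U : Set (Coord n)}
    {f : Coord n → F} (hf : ContDiffOn ℝ ∞ f U) (hU : IsOpen U) (j : Fin n) :
    ContDiffOn ℝ ∞ (pderiv j f) U :=
  (hf.fderiv_of_isOpen hU (by simp)).clm_apply contDiffOn_const

lemma pderiv_comm {U : Set (Coord n)} {f : Coord n → ℝ} (hf : ContDiffOn ℝ ∞ f U)
    (hU : IsOpen U) {y : Coord n} (hy : y ∈ U) (j k : Fin n) :
    pderiv j (pderiv k f) y = pderiv k (pderiv j f) y := by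
  have hd : DifferentiableAt ℝ (fderiv ℝ f) y :=
    ((hf.fderiv_of_isOpen hU (m := ∞) (by simp)).contDiffAt
      (hU.mem_nhds hy)).differentiableAt (by simp)
  have hs := ((hf.contDiffAt (hU.mem_nhds hy)).isSymmSndFDerivAt
    (by simpa using ENat.LEInfty.out)).eq
    (stdVec j) (stdVec k)
  have key : ∀ a b : Fin n, pderiv a (pderiv b f) y
      = fderiv ℝ (fderiv ℝ f) y (stdVec a) (stdVec b) := by
    intro a b
    have := hd.hasFDerivAt.clm_apply (hasFDerivAt_const (stdVec b) y)
    unfold _root_.pderiv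
    rw [this.fderiv]
    simp
  rw [key, key, hs]

lemma sum_sum_comm_sum_sum {ι R : Type*} [Fintype ι] [AddCommMonoid R] (T : ι → ι → ι → ι → R) :
    ∑ j, ∑ k, ∑ a, ∑ b, T j k a b = ∑ a, ∑ b, ∑ j, ∑ k, T j k a b := by
  calc ∑ j, ∑ k, ∑ a, ∑ b, T j k a b = ∑ j, ∑ a, ∑ k, ∑ b, T j k a b :=
        Finset.sum_congr rfl fun j _ ↦ Finset.sum_comm
    _ = ∑ a, ∑ j, ∑ k, ∑ b, T j k a b := Finset.sum_comm
    _ = ∑ a, ∑ j, ∑ b, ∑ k, T j k a b :=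
        Finset.sum_congr rfl fun a _ ↦ Finset.sum_congr rfl fun j _ ↦ Finset.sum_comm
    _ = ∑ a, ∑ b, ∑ j, ∑ k, T j k a b := Finset.sum_congr rfl fun a _ ↦ Finset.sum_comm

lemma clm_apply_eq_sum_stdVec {F : Type*} [NormedAddCommGroup F] [NormedSpace ℝ F]
    (L : Coord n →L[ℝ] F) (u : Coord n) : L u = ∑ j, u j • L (stdVec j) := by
  have hu : u = ∑ j, u j • stdVec j := by
    ext i
    simp [stdVec, Pi.single_apply]
  conv_lhs => rw [hu]
  simp

end Calculus

/-! ### The symbol and its Poisson bracket -/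

section Calculus

variable {n : ℕ}

/-- The symbol `|ξ + i df|²_g` of the conjugated Laplace-Beltrami operator of the metric with
matrix `G` and the weight `f`. -/
noncomputable def weightSymbol (G : Coord n → Matrix (Fin n) (Fin n) ℝ) (f : Coord n → ℝ)
    (z : Coord n × Coord n) : ℂ :=
  ∑ j, ∑ k, (((G z.1)⁻¹ j k : ℝ) : ℂ) * ((z.2 j + Complex.I * pderiv j f z.1)
    * (z.2 k + Complex.I * pderiv k f z.1))

/-- The components of the gradient of `f`. -/
noncomputable def gradComponent (G : Coord n → Matrix (Fin n) (Fin n) ℝ) (f : Coord n → ℝ)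
    (y : Coord n) (j : Fin n) : ℝ :=
  ∑ k, (G y)⁻¹ j k * pderiv k f y

/-- The components of the Hessian of `f` for the Levi-Civita connection. -/
noncomputable def hessianComponent (G : Coord n → Matrix (Fin n) (Fin n) ℝ) (f : Coord n → ℝ)
    (y : Coord n) (j m : Fin n) : ℝ :=
  hessianForm (fun j k l ↦ pderiv j (fun z ↦ G z k l) y) (fun j m ↦ pderiv j (pderiv m f) y)
    (gradComponent G f y) j m

variable {G : Coord n → Matrix (Fin n) (Fin n) ℝ} {U : Set (Coord n)} {y : Coord n}
  {f : Coord n → ℝ}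

/-- The derivative of the symbol, before the derivative of the inverse metric is expanded. -/
lemma hasFDerivAt_weightSymbol_apply (hG : IsSmoothMetricOn G U) (hf : ContDiffOn ℝ ∞ f U)
    (hy : y ∈ U) (ξ : Coord n) :
    ∃ L : Coord n × Coord n →L[ℝ] ℂ, HasFDerivAt (weightSymbol G f) L (y, ξ) ∧ ∀ u w : Coord n,
      L (u, w) = ∑ j, ∑ k, ((((G y)⁻¹ j k : ℝ) : ℂ)
        * ((ξ j + Complex.I * pderiv j f y) * (w k + Complex.I * fderiv ℝ (pderiv k f) y u)
          + (w j + Complex.I * fderiv ℝ (pderiv j f) y u) * (ξ k + Complex.I * pderiv k f y))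
        + (fderiv ℝ (fun y ↦ (G y)⁻¹ j k) y u : ℂ)
          * ((ξ j + Complex.I * pderiv j f y) * (ξ k + Complex.I * pderiv k f y))) := by
  have hH : ∀ j k, HasFDerivAt (fun z : Coord n × Coord n ↦ (((G z.1)⁻¹ j k : ℝ) : ℂ))
      (Complex.ofRealCLM.comp ((fderiv ℝ (fun y ↦ (G y)⁻¹ j k) y).comp
        (ContinuousLinearMap.fst ℝ _ _))) (y, ξ) := fun j k ↦
    Complex.ofRealCLM.hasFDerivAt.comp (y, ξ) (HasFDerivAt.comp (y, ξ)
      (g := fun y ↦ (G y)⁻¹ j k) (f := Prod.fst) (hG.inv_differentiableAt hy j k).hasFDerivAt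
        hasFDerivAt_fst)
  have hζ : ∀ k, HasFDerivAt
      (fun z : Coord n × Coord n ↦ ((z.2 k : ℝ) : ℂ) + Complex.I * ((pderiv k f z.1 : ℝ) : ℂ))
      ((Complex.ofRealCLM.comp ((EuclideanSpace.proj k).comp (ContinuousLinearMap.snd ℝ _ _)))
        + Complex.I • (Complex.ofRealCLM.comp ((fderiv ℝ (pderiv k f) y).comp
        (ContinuousLinearMap.fst ℝ _ _)))) (y, ξ) := fun k ↦ by
    refine HasFDerivAt.add ?_ (HasFDerivAt.const_mul ?_ _)
    · exact (Complex.ofRealCLM.comp ((EuclideanSpace.proj k).comp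
        (ContinuousLinearMap.snd ℝ (Coord n) (Coord n)))).hasFDerivAt
    · exact Complex.ofRealCLM.hasFDerivAt.comp (y, ξ) (HasFDerivAt.comp (y, ξ)
        (g := pderiv k f) (f := Prod.fst) ((((hf.pderiv hG.isOpen k).contDiffAt
          (hG.isOpen.mem_nhds hy)).differentiableAt (by simp)).hasFDerivAt) hasFDerivAt_fst)
  refine ⟨_, HasFDerivAt.fun_sum fun j _ ↦ HasFDerivAt.fun_sum fun k _ ↦
    (hH j k).mul ((hζ j).mul (hζ k)), fun u w ↦ ?_⟩
  simp only [_root_.sum_apply]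
  refine Finset.sum_congr rfl fun j _ ↦ Finset.sum_congr rfl fun k _ ↦ ?_
  simp
  ring

lemma differentiableAt_weightSymbol (hG : IsSmoothMetricOn G U) (hf : ContDiffOn ℝ ∞ f U)
    (hy : y ∈ U) (ξ : Coord n) : DifferentiableAt ℝ (weightSymbol G f) (y, ξ) :=
  (hasFDerivAt_weightSymbol_apply hG hf hy ξ).choose_spec.1.differentiableAt

/-- In `dG⁻¹ = -G⁻¹ dG G⁻¹` the two inverses raise the indices of the two factors `ξ + i df`. This
gives the derivative the shape required by `bracket_eq_hessianForm`. -/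
lemma fderiv_weightSymbol_apply (hG : IsSmoothMetricOn G U) (hf : ContDiffOn ℝ ∞ f U)
    (hy : y ∈ U) (ξ u w : Coord n) :
    fderiv ℝ (weightSymbol G f) (y, ξ) (u, w)
      = -(∑ k, ∑ l, (fderiv ℝ (fun y ↦ G y k l) y u : ℂ)
          * ((∑ m, (G y)⁻¹ k m * ξ m : ℝ) + Complex.I * gradComponent G f y k)
          * ((∑ m, (G y)⁻¹ l m * ξ m : ℝ) + Complex.I * gradComponent G f y l))
        + 2 * ∑ k, ((∑ m, (G y)⁻¹ k m * ξ m : ℝ) + Complex.I * gradComponent G f y k)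
          * (w k + Complex.I * fderiv ℝ (pderiv k f) y u) := by
  obtain ⟨L, hL, hLa⟩ := hasFDerivAt_weightSymbol_apply hG hf hy ξ
  rw [hL.fderiv, hLa]
  set ζ : Fin n → ℂ := fun j ↦ ξ j + Complex.I * pderiv j f y with hζ
  set dζ : Fin n → ℂ := fun j ↦ w j + Complex.I * fderiv ℝ (pderiv j f) y u with hdζ
  have hZ : ∀ k, (((∑ m, (G y)⁻¹ k m * ξ m : ℝ) : ℂ) + Complex.I * gradComponent G f y k)
      = ∑ m, ((G y)⁻¹ k m : ℂ) * ζ m := by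
    intro k
    simp only [gradComponent, hζ, mul_add, Finset.sum_add_distrib]
    push_cast
    rw [Finset.mul_sum]
    congr 1
    exact Finset.sum_congr rfl fun m _ ↦ by ring
  have hdH : ∀ j k, (fderiv ℝ (fun y ↦ (G y)⁻¹ j k) y u : ℂ)
      = -∑ a, ∑ b, ((G y)⁻¹ a j : ℂ) * (fderiv ℝ (fun y ↦ G y a b) y u : ℂ) * ((G y)⁻¹ b k : ℂ) := by
    intro j k
    have := congr($(hG.fderiv_inv hy u) j k)
    simp only [Matrix.of_apply, Matrix.neg_apply, Matrix.mul_apply, Finset.sum_mul] at this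
    rw [this, Finset.sum_comm]
    push_cast
    simp only [hG.inv_symm hy j]
  simp only [hZ, hdH]
  have e1 : ∀ j k : Fin n, ((((G y)⁻¹ j k : ℝ) : ℂ) * (ζ j * dζ k + dζ j * ζ k))
      = ((G y)⁻¹ k j : ℂ) * ζ j * dζ k + ((G y)⁻¹ j k : ℂ) * ζ k * dζ j := by
    intro j k
    rw [hG.inv_symm hy k j]
    ring
  change ∑ j, ∑ k, (((((G y)⁻¹ j k : ℝ) : ℂ) * (ζ j * dζ k + dζ j * ζ k)) + _ * (ζ j * ζ k)) = _
  simp only [e1, Finset.sum_add_distrib]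
  rw [add_comm]
  congr 1
  · simp only [neg_mul, Finset.sum_neg_distrib, Finset.sum_mul, Finset.mul_sum]
    congr 1
    rw [sum_sum_comm_sum_sum]
    refine Finset.sum_congr rfl fun a _ ↦ Finset.sum_congr rfl fun b _ ↦
      Eq.trans ?_ Finset.sum_comm
    refine Finset.sum_congr rfl fun j _ ↦ Finset.sum_congr rfl fun k _ ↦ ?_
    ring
  · rw [Finset.sum_comm, two_mul]
    simp only [Finset.sum_mul]
    rfl

/-- The Poisson bracket of the symbol with its conjugate is the Hessian of the weight, evaluated
on the real and the imaginary part of the momentum. -/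
theorem poissonBracket_weightSymbol (hG : IsSmoothMetricOn G U) (hf : ContDiffOn ℝ ∞ f U)
    (hy : y ∈ U) (ξ : Coord n) :
    poissonBracket (fun z ↦ conj (weightSymbol G f z)) (weightSymbol G f) (y, ξ)
      = 8 * Complex.I * ((∑ j, ∑ m, hessianComponent G f y j m
          * (∑ k, (G y)⁻¹ j k * ξ k) * (∑ k, (G y)⁻¹ m k * ξ k)
        + ∑ j, ∑ m, hessianComponent G f y j m
          * gradComponent G f y j * gradComponent G f y m : ℝ) : ℂ) := by
  have hconj : ∀ v, fderiv ℝ (fun z ↦ conj (weightSymbol G f z)) (y, ξ) v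
      = conj (fderiv ℝ (weightSymbol G f) (y, ξ) v) := by
    intro v
    have := (Complex.conjCLE.hasFDerivAt (x := weightSymbol G f (y, ξ))).comp (y, ξ)
      (differentiableAt_weightSymbol hG hf hy ξ).hasFDerivAt
    exact congr($(this.fderiv) v)
  have hsymm : ∀ j k l : Fin n, pderiv j (fun z ↦ G z k l) y = pderiv j (fun z ↦ G z l k) y := by
    intro j k l
    have : (fun z ↦ G z k l) =ᶠ[𝓝 y] fun z ↦ G z l k := by
      filter_upwards [hG.isOpen.mem_nhds hy] with z hz using hG.symm hz k l
    rw [pderiv, this.fderiv_eq, pderiv]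
  unfold poissonBracket
  simp only [hconj]
  refine bracket_eq_hessianForm _ hsymm _ _ _
    (fun j ↦ fderiv ℝ (weightSymbol G f) (y, ξ) (0, stdVec j))
    (fun j ↦ fderiv ℝ (weightSymbol G f) (y, ξ) (stdVec j, 0)) (fun j ↦ ?_) fun j ↦ ?_
  · rw [fderiv_weightSymbol_apply hG hf hy]
    simp [stdVec, apply_ite]
  · rw [fderiv_weightSymbol_apply hG hf hy]
    congr 1
    simp only [Finset.mul_sum]
    refine Finset.sum_congr rfl fun k _ ↦ ?_
    simp [pderiv]
    ring

end Calculus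

/-! ### Conformal change, and the Hessian as derivative of the gradient -/

section Calculus

variable {n : ℕ}

/-- The components `∂_j X^l + Γ^l_{jk} X^k` of the covariant derivative of a vector field with
components `X`. -/
noncomputable def covDerivComponent (G : Coord n → Matrix (Fin n) (Fin n) ℝ)
    (X : Fin n → Coord n → ℝ) (j l : Fin n) (y : Coord n) : ℝ :=
  pderiv j (X l) y + ∑ k, ((1 / 2) * ∑ m, (G y)⁻¹ l m *
    (pderiv j (fun z ↦ G z k m) y + pderiv k (fun z ↦ G z j m) y
      - pderiv m (fun z ↦ G z j k) y)) * X k y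

lemma poissonBracket_congr {a b a' b' : Coord n × Coord n → ℂ} {z : Coord n × Coord n}
    (ha : a =ᶠ[𝓝 z] a') (hb : b =ᶠ[𝓝 z] b') : poissonBracket a b z = poissonBracket a' b' z := by
  unfold poissonBracket
  rw [ha.fderiv_eq, hb.fderiv_eq]

/-- On the zero set of `p`, the condition `{p̄, p} = 0` is invariant under multiplication of `p`
with a real function. -/
lemma poissonBracket_conj_real_mul {p : Coord n × Coord n → ℂ} {c : Coord n × Coord n → ℝ}
    {z : Coord n × Coord n} (hc : DifferentiableAt ℝ c z) (hp : DifferentiableAt ℝ p z)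
    (hz : p z = 0) :
    poissonBracket (fun z ↦ conj ((c z : ℂ) * p z)) (fun z ↦ (c z : ℂ) * p z) z
      = (c z : ℂ) ^ 2 * poissonBracket (fun z ↦ conj (p z)) p z := by
  have hconj : ∀ {q : Coord n × Coord n → ℂ}, DifferentiableAt ℝ q z → ∀ v,
      fderiv ℝ (fun z ↦ conj (q z)) z v = conj (fderiv ℝ q z v) := by
    intro q hq v
    have := (Complex.conjCLE.hasFDerivAt (x := q z)).comp z hq.hasFDerivAt
    exact congr($(this.fderiv) v)
  have hmul : HasFDerivAt (fun z ↦ (c z : ℂ) * p z) _ z := (Complex.ofRealCLM.hasFDerivAt.comp z hc.hasFDerivAt).mul hp.hasFDerivAt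
  -- The term `p dc` of the product rule drops out because `p z = 0`.
  have hmul' : ∀ v, fderiv ℝ (fun z ↦ (c z : ℂ) * p z) z v = (c z : ℂ) * fderiv ℝ p z v := by
    intro v
    have := congr($(hmul.fderiv) v)
    simpa [hz] using this
  have hd : DifferentiableAt ℝ (fun z ↦ (c z : ℂ) * p z) z := hmul.differentiableAt
  simp only [poissonBracket, hconj hp, hconj hd]
  simp only [hmul', map_mul, Complex.conj_ofReal,
    Finset.mul_sum]
  exact Finset.sum_congr rfl fun j _ ↦ by ring

variable {G : Coord n → Matrix (Fin n) (Fin n) ℝ} {U : Set (Coord n)} {y : Coord n}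
  {f : Coord n → ℝ}

lemma weightSymbol_smul (hG : IsSmoothMetricOn G U) (hy : y ∈ U) {c : Coord n → ℝ}
    (hpos : 0 < c y) (ξ : Coord n) :
    weightSymbol G f (y, ξ) = (c y : ℂ) * weightSymbol (fun y ↦ c y • G y) f (y, ξ) := by
  have h : (c y • G y)⁻¹ = (c y)⁻¹ • (G y)⁻¹ := by
    have := Matrix.inv_smul' (A := G y) (Units.mk0 (c y) hpos.ne') (hG.det_pos hy).ne'.isUnit
    simpa [Units.smul_def] using this
  have hc : (c y : ℂ) ≠ 0 := by exact_mod_cast hpos.ne'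
  simp only [weightSymbol, h, Finset.mul_sum]
  refine Finset.sum_congr rfl fun j _ ↦ Finset.sum_congr rfl fun k _ ↦ ?_
  simp
  field_simp

/-- Separating real and imaginary parts shows the zero set: `|ξ| = |df|` and `ξ ⊥ df`. The two cross
terms agree by symmetry of `G⁻¹`. -/
lemma weightSymbol_eq (hG : IsSmoothMetricOn G U) (hy : y ∈ U) (ξ : Coord n) :
    weightSymbol G f (y, ξ) = ((∑ j, ξ j * (∑ k, (G y)⁻¹ j k * ξ k)
        - ∑ j, gradComponent G f y j * pderiv j f y : ℝ) : ℂ)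
      + Complex.I * ((2 * ∑ j, gradComponent G f y j * ξ j : ℝ) : ℂ) := by
  have hsw : ∑ j, ∑ k, (G y)⁻¹ j k * (ξ j * pderiv k f y)
      = ∑ j, ∑ k, (G y)⁻¹ j k * (ξ k * pderiv j f y) := by
    rw [Finset.sum_comm]
    exact Finset.sum_congr rfl fun j _ ↦ Finset.sum_congr rfl fun k _ ↦ by rw [hG.inv_symm hy]
  have hX : ∑ j, gradComponent G f y j * ξ j = ∑ j, ∑ k, (G y)⁻¹ j k * (ξ j * pderiv k f y) := by
    simp only [gradComponent, Finset.sum_mul]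
    exact Finset.sum_congr rfl fun j _ ↦ Finset.sum_congr rfl fun k _ ↦ by ring
  rw [two_mul, hX]
  nth_rewrite 1 [hsw]
  simp only [weightSymbol, gradComponent]
  push_cast
  simp only [Finset.mul_sum, Finset.sum_mul, ← Finset.sum_add_distrib, ← Finset.sum_sub_distrib]
  refine Finset.sum_congr rfl fun j _ ↦ Finset.sum_congr rfl fun k _ ↦ ?_
  linear_combination ((G y)⁻¹ j k : ℂ) * (pderiv j f y : ℝ) * (pderiv k f y : ℝ) * Complex.I_sq

lemma IsSmoothMetricOn.pderiv_symm (hG : IsSmoothMetricOn G U) (hy : y ∈ U) (j k l : Fin n) :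
    pderiv j (fun z ↦ G z k l) y = pderiv j (fun z ↦ G z l k) y := by
  have : (fun z ↦ G z k l) =ᶠ[𝓝 y] fun z ↦ G z l k := by
    filter_upwards [hG.isOpen.mem_nhds hy] with z hz using hG.symm hz k l
  rw [pderiv, this.fderiv_eq, pderiv]

lemma pderiv_congr_of_eqOn {F : Type*} [NormedAddCommGroup F] [NormedSpace ℝ F] {a b : Coord n → F}
    (hU : IsOpen U) (hab : Set.EqOn a b U) (hy : y ∈ U) (j : Fin n) :
    pderiv j a y = pderiv j b y := by
  rw [pderiv, (hab.eventuallyEq_of_mem (hU.mem_nhds hy)).fderiv_eq, pderiv]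

lemma pderiv_sum_mul {ι : Type*} [Fintype ι] {a b : ι → Coord n → ℝ}
    (ha : ∀ l, DifferentiableAt ℝ (a l) y) (hb : ∀ l, DifferentiableAt ℝ (b l) y) (j : Fin n) :
    pderiv j (fun z ↦ ∑ l, a l z * b l z) y
      = ∑ l, (pderiv j (a l) y * b l y + a l y * pderiv j (b l) y) := by
  have : HasFDerivAt (fun z ↦ ∑ l, a l z * b l z) _ y := HasFDerivAt.fun_sum fun l _ ↦
    (ha l).hasFDerivAt.mul (hb l).hasFDerivAt
  rw [pderiv, this.fderiv]
  simp only [_root_.sum_apply]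
  refine Finset.sum_congr rfl fun l _ ↦ ?_
  simp [pderiv]
  ring

lemma IsSmoothMetricOn.sum_mul_sum_inv (hG : IsSmoothMetricOn G U) (hy : y ∈ U) (w : Fin n → ℝ)
    (m : Fin n) : ∑ l, G y m l * ∑ k, (G y)⁻¹ l k * w k = w m := by
  have := congr(Matrix.mulVec $(hG.mul_inv hy) w)
  rw [← Matrix.mulVec_mulVec, Matrix.one_mulVec] at this
  exact congr_fun this m

lemma IsSmoothMetricOn.sum_inv_mul_sum (hG : IsSmoothMetricOn G U) (hy : y ∈ U) (w : Fin n → ℝ)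
    (m : Fin n) : ∑ l, (G y)⁻¹ m l * ∑ k, G y l k * w k = w m := by
  have := congr(Matrix.mulVec $(hG.inv_mul hy) w)
  rw [← Matrix.mulVec_mulVec, Matrix.one_mulVec] at this
  exact congr_fun this m

/-- The covariant derivative with the vector index lowered. -/
lemma sum_mul_covDerivComponent (hG : IsSmoothMetricOn G U) (hy : y ∈ U)
    {X : Fin n → Coord n → ℝ} (hX : ∀ l, DifferentiableAt ℝ (X l) y) (j m : Fin n) :
    ∑ l, G y m l * covDerivComponent G X j l y
      = pderiv j (fun z ↦ ∑ l, G z m l * X l z) y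
        - (1 / 2) * ∑ k, (pderiv j (fun z ↦ G z m k) y + pderiv m (fun z ↦ G z j k) y
          - pderiv k (fun z ↦ G z j m) y) * X k y := by
  rw [pderiv_sum_mul (fun l ↦ hG.differentiableAt hy m l) hX]
  -- With `G⁻¹` moved outermost, lowering the index cancels it.
  have key : ∀ l, covDerivComponent G X j l y = pderiv j (X l) y
      + ∑ a, (G y)⁻¹ l a * ∑ k, (1 / 2) * (pderiv j (fun z ↦ G z k a) y
        + pderiv k (fun z ↦ G z j a) y - pderiv a (fun z ↦ G z j k) y) * X k y := by
    intro l
    simp only [covDerivComponent, Finset.mul_sum, Finset.sum_mul]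
    rw [Finset.sum_comm]
    congr 1
    exact Finset.sum_congr rfl fun a _ ↦ Finset.sum_congr rfl fun k _ ↦ by ring
  simp only [key, mul_add, Finset.sum_add_distrib, hG.sum_mul_sum_inv hy]
  have e : ∑ k, (1 / 2) * (pderiv j (fun z ↦ G z k m) y + pderiv k (fun z ↦ G z j m) y
        - pderiv m (fun z ↦ G z j k) y) * X k y
      = ∑ k, pderiv j (fun z ↦ G z m k) y * X k y
        - (1 / 2) * ∑ k, (pderiv j (fun z ↦ G z m k) y + pderiv m (fun z ↦ G z j k) y
          - pderiv k (fun z ↦ G z j m) y) * X k y := by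
    simp only [Finset.mul_sum, ← Finset.sum_sub_distrib]
    refine Finset.sum_congr rfl fun k _ ↦ ?_
    rw [hG.pderiv_symm hy j k m]
    ring
  rw [e]
  ring

/-- The gradient of `f`, with lowered index, is `df`. -/
lemma sum_mul_gradComponent (hG : IsSmoothMetricOn G U) (hy : y ∈ U) (m : Fin n) :
    ∑ l, G y m l * gradComponent G f y l = pderiv m f y :=
  hG.sum_mul_sum_inv hy _ m

lemma gradComponent_differentiableAt (hG : IsSmoothMetricOn G U) (hf : ContDiffOn ℝ ∞ f U)
    (hy : y ∈ U) (l : Fin n) : DifferentiableAt ℝ (fun z ↦ gradComponent G f z l) y := by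
  have : ContDiffOn ℝ ∞ (fun z ↦ gradComponent G f z l) U :=
    ContDiffOn.sum fun k _ ↦ (hG.inv_smooth l k).mul (hf.pderiv hG.isOpen k)
  exact (this.contDiffAt (hG.isOpen.mem_nhds hy)).differentiableAt (by simp)

/-- The covariant derivative of the gradient is the Hessian. -/
lemma sum_mul_covDerivComponent_grad (hG : IsSmoothMetricOn G U) (hf : ContDiffOn ℝ ∞ f U)
    (hy : y ∈ U) (j m : Fin n) :
    ∑ l, G y m l * covDerivComponent G (fun l z ↦ gradComponent G f z l) j l y
      = hessianComponent G f y j m := by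
  rw [sum_mul_covDerivComponent hG hy (gradComponent_differentiableAt hG hf hy),
    pderiv_congr_of_eqOn hG.isOpen (b := pderiv m f)
      (fun z hz ↦ sum_mul_gradComponent hG hz m) hy]
  rfl

/-- The two tensors differ by lowering an index, which is invertible. -/
lemma covDerivComponent_grad_eq_zero_iff (hG : IsSmoothMetricOn G U) (hf : ContDiffOn ℝ ∞ f U)
    (hy : y ∈ U) :
    (∀ j l, covDerivComponent G (fun l z ↦ gradComponent G f z l) j l y = 0)
      ↔ ∀ j m, hessianComponent G f y j m = 0 := by
  refine ⟨fun h j m ↦ ?_, fun h j l ↦ ?_⟩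
  · rw [← sum_mul_covDerivComponent_grad hG hf hy]
    simp [h]
  · rw [← hG.sum_inv_mul_sum hy (fun l ↦ covDerivComponent G _ j l y) l]
    simp [sum_mul_covDerivComponent_grad hG hf hy, h]

lemma hessianComponent_symm (hG : IsSmoothMetricOn G U) (hf : ContDiffOn ℝ ∞ f U)
    (hy : y ∈ U) (j m : Fin n) : hessianComponent G f y j m = hessianComponent G f y m j := by
  simp only [hessianComponent, hessianForm]
  rw [pderiv_comm hf hG.isOpen hy j m]
  congr 2
  refine Finset.sum_congr rfl fun k _ ↦ ?_
  rw [hG.pderiv_symm hy k j m]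
  ring

/-- If `|df| = 1`, then the Hessian of `f` vanishes on the gradient. -/
lemma sum_hessianComponent_mul_grad (hG : IsSmoothMetricOn G U) (hf : ContDiffOn ℝ ∞ f U)
    (hunit : ∀ z ∈ U, ∑ j, gradComponent G f z j * pderiv j f z = 1) (hy : y ∈ U) (j : Fin n) :
    ∑ m, hessianComponent G f y j m * gradComponent G f y m = 0 := by
  have hX := gradComponent_differentiableAt hG hf hy
  have hdf : ∀ m, DifferentiableAt ℝ (pderiv m f) y := fun m ↦
    ((hf.pderiv hG.isOpen m).contDiffAt (hG.isOpen.mem_nhds hy)).differentiableAt (by simp)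
  -- Differentiate `df(X) = 1`. Substituting the derivative of `df = GX` (`h2`, `h3`) yields `2 X^m
  -- ∂_j∂_m f = ∂_j G(X, X)`.
  have h1 : ∑ m, (pderiv j (fun z ↦ gradComponent G f z m) y * pderiv m f y
      + gradComponent G f y m * pderiv j (pderiv m f) y) = 0 := by
    rw [← pderiv_sum_mul hX hdf, pderiv_congr_of_eqOn hG.isOpen (b := fun _ ↦ (1 : ℝ)) hunit hy]
    simp [pderiv]
  have h2 : ∀ m, pderiv j (pderiv m f) y = ∑ l, (pderiv j (fun z ↦ G z m l) y * gradComponent G f y l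
      + G y m l * pderiv j (fun z ↦ gradComponent G f z l) y) := by
    intro m
    rw [← pderiv_sum_mul (fun l ↦ hG.differentiableAt hy m l) hX]
    exact pderiv_congr_of_eqOn hG.isOpen (fun z hz ↦ (sum_mul_gradComponent hG hz m).symm) hy _
  have h3 : ∑ m, gradComponent G f y m * pderiv j (pderiv m f) y
      = ∑ m, ∑ l, pderiv j (fun z ↦ G z m l) y * gradComponent G f y l * gradComponent G f y m
        + ∑ m, pderiv j (fun z ↦ gradComponent G f z m) y * pderiv m f y := by
    have h5 : ∑ m, pderiv j (fun z ↦ gradComponent G f z m) y * pderiv m f y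
        = ∑ m, pderiv j (fun z ↦ gradComponent G f z m) y
          * ∑ l, G y m l * gradComponent G f y l :=
      Finset.sum_congr rfl fun m _ ↦ by rw [sum_mul_gradComponent hG hy]
    rw [h5]
    simp only [h2, Finset.mul_sum, mul_add, Finset.sum_add_distrib]
    congr 1
    · exact Finset.sum_congr rfl fun j _ ↦ Finset.sum_congr rfl fun k _ ↦ by ring
    · rw [Finset.sum_comm]
      refine Finset.sum_congr rfl fun a _ ↦ Finset.sum_congr rfl fun k _ ↦ ?_
      rw [hG.symm hy a k]
      ring
  -- Of the three Christoffel terms, two cancel when both remaining indices are contracted with `X`.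
  have h4 : ∑ m, hessianComponent G f y j m * gradComponent G f y m
      = ∑ m, gradComponent G f y m * pderiv j (pderiv m f) y
      - (1 / 2) * ∑ m, ∑ l, pderiv j (fun z ↦ G z m l) y
        * gradComponent G f y l * gradComponent G f y m := by
    have hsw : ∑ m, ∑ k, pderiv m (fun z ↦ G z j k) y * gradComponent G f y k
          * gradComponent G f y m
        = ∑ m, ∑ k, pderiv k (fun z ↦ G z j m) y * gradComponent G f y k
          * gradComponent G f y m := by
      rw [Finset.sum_comm]
      exact Finset.sum_congr rfl fun j _ ↦ Finset.sum_congr rfl fun k _ ↦ by ring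
    have : ∑ m, hessianComponent G f y j m * gradComponent G f y m
      = ∑ m, gradComponent G f y m * pderiv j (pderiv m f) y
      - (1 / 2) * (∑ m, ∑ l, pderiv j (fun z ↦ G z m l) y
        * gradComponent G f y l * gradComponent G f y m +
        ∑ m, ∑ k, pderiv m (fun z ↦ G z j k) y * gradComponent G f y k
          * gradComponent G f y m - ∑ m, ∑ k, pderiv k (fun z ↦ G z j m) y * gradComponent G f y k
          * gradComponent G f y m) := by
      simp only [hessianComponent, hessianForm, sub_mul, Finset.mul_sum, Finset.sum_mul,
        ← Finset.sum_add_distrib, ← Finset.sum_sub_distrib, mul_sub, mul_add, add_mul]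
      refine Finset.sum_congr rfl fun m _ ↦ ?_
      congr 1
      · ring
      · exact Finset.sum_congr rfl fun j _ ↦ by ring
    rw [this, hsw]
    ring
  rw [Finset.sum_add_distrib] at h1
  rw [h4]
  linarith

end Calculus

/-! ### Vanishing of the Hessian and conformal invariance -/

section Calculus

variable {n : ℕ} {G : Coord n → Matrix (Fin n) (Fin n) ℝ} {U : Set (Coord n)} {y : Coord n}
  {f : Coord n → ℝ}

/-- Polarization: test on the vectors `e_i` and `e_i + e_j`. -/
lemma Matrix.eq_zero_of_isSymm_of_forall_dotProduct {ι : Type*} [Fintype ι] [DecidableEq ι]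
    {S : Matrix ι ι ℝ} (hS : ∀ i j, S i j = S j i) (h : ∀ w : ι → ℝ, w ⬝ᵥ S.mulVec w = 0) :
    S = 0 := by
  have hd : ∀ i, S i i = 0 := fun i ↦ by simpa using h (Pi.single i 1)
  ext i j
  have := h (Pi.single i 1 + Pi.single j 1)
  simp [Matrix.mulVec_add, hd, hS j i] at this
  simpa using this

lemma sum_sum_mul_mul_eq_dotProduct {ι : Type*} [Fintype ι] (S : ι → ι → ℝ) (u w : ι → ℝ) :
    ∑ j, ∑ m, S j m * u j * w m = u ⬝ᵥ (Matrix.of S).mulVec w := by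
  simp only [dotProduct, Matrix.mulVec, Matrix.of_apply, Finset.mul_sum]
  exact Finset.sum_congr rfl fun j _ ↦ Finset.sum_congr rfl fun k _ ↦ by ring

/-- If `|df| = 1` and the bracket condition holds for `f`, then the Hessian of `f` vanishes. -/
theorem hessianComponent_eq_zero (hG : IsSmoothMetricOn G U) (hf : ContDiffOn ℝ ∞ f U)
    (hunit : ∀ z ∈ U, ∑ j, gradComponent G f z j * pderiv j f z = 1) (hy : y ∈ U)
    (hbr : ∀ ξ, weightSymbol G f (y, ξ) = 0 →
      poissonBracket (fun z ↦ conj (weightSymbol G f z)) (weightSymbol G f) (y, ξ) = 0)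
    (j m : Fin n) : hessianComponent G f y j m = 0 := by
  set S : Matrix (Fin n) (Fin n) ℝ := Matrix.of (hessianComponent G f y) with hSdef
  set X : Fin n → ℝ := gradComponent G f y with hXdef
  set df : Fin n → ℝ := fun j ↦ pderiv j f y with hdf
  have hSX : S.mulVec X = 0 := by
    ext j
    exact sum_hessianComponent_mul_grad hG hf hunit hy j
  have hsymm : ∀ i j, S i j = S j i := fun i j ↦ hessianComponent_symm hG hf hy i j
  have hST : S.transpose = S := by
    ext i j
    exact hsymm j i
  have hXS : ∀ w, X ⬝ᵥ S.mulVec w = 0 := by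
    intro w
    rw [Matrix.dotProduct_mulVec, ← Matrix.mulVec_transpose, hST, hSX, zero_dotProduct]
  have hGX : (G y).mulVec X = df := by
    ext m
    exact sum_mul_gradComponent hG hy m
  have hXdf : X ⬝ᵥ df = 1 := hunit y hy
  have hGT : (G y).transpose = G y := by
    ext i j
    exact hG.symm hy j i
  -- For a unit vector `v ⊥ X` the covector `Gv` lies in the zero set of the symbol, since `|df| =
  -- 1`. The bracket there reduces to `S(v, v)`, because `S(X, X) = 0`.
  have hunitperp : ∀ v : Fin n → ℝ, v ⬝ᵥ df = 0 → v ⬝ᵥ (G y).mulVec v = 1 →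
      v ⬝ᵥ S.mulVec v = 0 := by
    intro v hv hv1
    set ξ : Coord n := WithLp.toLp 2 ((G y).mulVec v) with hξ
    have hHξ : ∀ j, ∑ k, (G y)⁻¹ j k * ξ k = v j := fun j ↦ hG.sum_inv_mul_sum hy v j
    have h0 : weightSymbol G f (y, ξ) = 0 := by
      rw [weightSymbol_eq hG hy]
      have e1 : ∑ j, ξ j * v j = 1 := by
        rw [← hv1, dotProduct_comm]
        rfl
      have e2 : ∑ j, gradComponent G f y j * ξ j = 0 := by
        change X ⬝ᵥ (G y).mulVec v = 0
        rw [Matrix.dotProduct_mulVec, ← Matrix.mulVec_transpose, hGT, hGX, dotProduct_comm, hv]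
      simp only [hHξ, e1, e2, hunit y hy]
      simp
    have hb := hbr ξ h0
    rw [poissonBracket_weightSymbol hG hf hy] at hb
    simp only [hHξ, sum_sum_mul_mul_eq_dotProduct] at hb
    have hXX : X ⬝ᵥ S.mulVec X = 0 := hXS X
    change 8 * Complex.I * ((v ⬝ᵥ S.mulVec v + X ⬝ᵥ S.mulVec X : ℝ) : ℂ) = 0 at hb
    rw [hXX, add_zero] at hb
    simpa using hb
  have hperp : ∀ u : Fin n → ℝ, u ⬝ᵥ df = 0 → u ⬝ᵥ S.mulVec u = 0 := by
    intro u hu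
    by_cases h0 : u = 0
    · simp [h0]
    have hpos : 0 < u ⬝ᵥ (G y).mulVec u := by
      simpa using (hG.posDef y hy).dotProduct_mulVec_pos h0
    set r := √(u ⬝ᵥ (G y).mulVec u) with hr
    have hr0 : r ≠ 0 := (Real.sqrt_pos.2 hpos).ne'
    have hrr : r * r = u ⬝ᵥ (G y).mulVec u := Real.mul_self_sqrt hpos.le
    have := hunitperp (r⁻¹ • u) (by simp [hu]) (by
      simp [Matrix.mulVec_smul, ← hrr]
      field_simp)
    simpa [Matrix.mulVec_smul, hr0] using this
  have hall : ∀ w : Fin n → ℝ, w ⬝ᵥ S.mulVec w = 0 := by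
    intro w
    -- Subtracting `df(w) X` makes `w` orthogonal to `X`, since `df(X) = 1`, and leaves `S(w, w)`
    -- unchanged, since `X` is in the kernel of `S`.
    have h := hperp (w - (w ⬝ᵥ df) • X) (by simp [sub_dotProduct, hXdf])
    simpa [Matrix.mulVec_sub, Matrix.mulVec_smul, hSX, hXS, sub_dotProduct] using h
  exact congr($(Matrix.eq_zero_of_isSymm_of_forall_dotProduct hsymm hall) j m)

/-- The bracket condition is conformally invariant. -/
theorem bracket_condition_smul_iff (hG : IsSmoothMetricOn G U) (hf : ContDiffOn ℝ ∞ f U)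
    {c : Coord n → ℝ} (hc : ContDiffOn ℝ ∞ c U) (hpos : ∀ y ∈ U, 0 < c y) (hy : y ∈ U) :
    (∀ ξ, weightSymbol (fun y ↦ c y • G y) f (y, ξ) = 0 →
      poissonBracket (fun z ↦ conj (weightSymbol (fun y ↦ c y • G y) f z))
        (weightSymbol (fun y ↦ c y • G y) f) (y, ξ) = 0) ↔
    (∀ ξ, weightSymbol G f (y, ξ) = 0 →
      poissonBracket (fun z ↦ conj (weightSymbol G f z)) (weightSymbol G f) (y, ξ) = 0) := by
  have hc0 : (c y : ℂ) ≠ 0 := by exact_mod_cast (hpos y hy).ne'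
  refine forall_congr' fun ξ ↦ ?_
  have hz : weightSymbol G f (y, ξ) = 0 ↔ weightSymbol (fun y ↦ c y • G y) f (y, ξ) = 0 := by
    rw [weightSymbol_smul hG hy (hpos y hy)]
    simp [hc0]
  rw [hz]
  refine imp_congr_right fun h0 ↦ ?_
  -- The bracket involves derivatives, so the identity is needed on a neighbourhood of the point.
  have hev : weightSymbol G f =ᶠ[𝓝 (y, ξ)]
      fun z ↦ ((c z.1 : ℝ) : ℂ) * weightSymbol (fun y ↦ c y • G y) f z := by
    have hmem : ∀ᶠ z : Coord n × Coord n in 𝓝 (y, ξ), z.1 ∈ U :=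
      continuousAt_fst.eventually (hG.isOpen.mem_nhds hy)
    filter_upwards [hmem] with z hz
    exact weightSymbol_smul hG hz (hpos _ hz) z.2
  have hcd : DifferentiableAt ℝ c y :=
    (hc.contDiffAt (hG.isOpen.mem_nhds hy)).differentiableAt (by simp)
  have := poissonBracket_conj_real_mul (c := fun z ↦ c z.1) (z := (y, ξ))
    (hcd.comp (y, ξ) differentiableAt_fst)
    (differentiableAt_weightSymbol (hG.conformal hc hpos) hf hy ξ) h0
  have hbr := (poissonBracket_congr (hev.fun_comp conj) hev).trans this
  refine Iff.trans ?_ (Iff.of_eq (congrArg (· = (0 : ℂ)) hbr.symm))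
  simp [hc0]

end Calculus

/-! ### The principal symbol of the conjugated operator -/

section Calculus

variable {n : ℕ} {G : Coord n → Matrix (Fin n) (Fin n) ℝ} {U : Set (Coord n)} {y : Coord n}
  {f : Coord n → ℝ}

/-- A second order divergence form expression, applied to an exponential `exp (ψ / h)`. -/
lemma sum_pderiv_mul_pderiv_cexp {A : Fin n → Fin n → Coord n → ℝ} {ψ : Coord n → ℂ}
    (hU : IsOpen U) (hA : ∀ j k, ContDiffOn ℝ ∞ (A j k) U) (hψ : ContDiffOn ℝ ∞ ψ U) (hy : y ∈ U)
    (h : ℝ) :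
    ∑ j, ∑ k, pderiv j (fun z ↦ (A j k z : ℂ) * pderiv k (fun z ↦ Complex.exp (ψ z / h)) z) y
      = Complex.exp (ψ y / h) * ((∑ j, ∑ k, (A j k y : ℂ) * (pderiv j ψ y * pderiv k ψ y)) / h ^ 2
        + (∑ j, ∑ k, pderiv j (fun z ↦ (A j k z : ℂ) * pderiv k ψ z) y) / h) := by
  have hexp : ∀ z ∈ U, HasFDerivAt (fun z ↦ Complex.exp (ψ z / h))
      (Complex.exp (ψ z / h) • ((h : ℂ)⁻¹ • fderiv ℝ ψ z)) z := by
    intro z hz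
    have h1 : DifferentiableAt ℝ ψ z :=
      (hψ.contDiffAt (hU.mem_nhds hz)).differentiableAt (by simp)
    have h2 : HasFDerivAt (fun z ↦ ψ z / (h : ℂ)) ((h : ℂ)⁻¹ • fderiv ℝ ψ z) z := by
      simpa only [div_eq_mul_inv] using h1.hasFDerivAt.mul_const (h : ℂ)⁻¹
    exact h2.cexp
  have hpd : ∀ k, ∀ z ∈ U, pderiv k (fun z ↦ Complex.exp (ψ z / h)) z
      = Complex.exp (ψ z / h) * ((h : ℂ)⁻¹ * pderiv k ψ z) := by
    intro k z hz
    rw [pderiv, (hexp z hz).fderiv]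
    simp [pderiv]
  have hterm : ∀ j k, pderiv j (fun z ↦ (A j k z : ℂ)
        * pderiv k (fun z ↦ Complex.exp (ψ z / h)) z) y
      = Complex.exp (ψ y / h) * ((A j k y : ℂ) * (pderiv j ψ y * pderiv k ψ y) / h ^ 2
        + pderiv j (fun z ↦ (A j k z : ℂ) * pderiv k ψ z) y / h) := by
    intro j k
    have hB : DifferentiableAt ℝ (fun z ↦ (A j k z : ℂ) * pderiv k ψ z) y := by
      have h1 : DifferentiableAt ℝ (A j k) y :=
        ((hA j k).contDiffAt (hU.mem_nhds hy)).differentiableAt (by simp)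
      have h2 : DifferentiableAt ℝ (pderiv k ψ) y :=
        ((hψ.pderiv hU k).contDiffAt (hU.mem_nhds hy)).differentiableAt (by simp)
      exact (Complex.ofRealCLM.differentiableAt.comp y h1).mul h2
    have heq : Set.EqOn (fun z ↦ (A j k z : ℂ) * pderiv k (fun z ↦ Complex.exp (ψ z / h)) z)
        (fun z ↦ Complex.exp (ψ z / h) * ((h : ℂ)⁻¹ * ((A j k z : ℂ) * pderiv k ψ z))) U := by
      intro z hz
      simp only [hpd k z hz]
      ring
    rw [pderiv_congr_of_eqOn hU heq hy]
    have hd : HasFDerivAt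
        (fun z ↦ Complex.exp (ψ z / h) * ((h : ℂ)⁻¹ * ((A j k z : ℂ) * pderiv k ψ z))) _ y :=
      (hexp y hy).mul (hB.hasFDerivAt.const_mul (h : ℂ)⁻¹)
    rw [pderiv, hd.fderiv]
    simp [pderiv]
    ring
  simp only [hterm, ← Finset.mul_sum, Finset.sum_add_distrib, Finset.sum_div]

/-- The principal symbol of the conjugated Laplace-Beltrami operator, in coordinates. -/
theorem tendsto_conjugated_laplace (hG : IsSmoothMetricOn G U) (hf : ContDiffOn ℝ ∞ f U)
    (hy : y ∈ U) (ξ : Coord n) :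
    Tendsto (fun h : ℝ ↦ Complex.exp (-(Complex.I * ((∑ j, y j * ξ j : ℝ) : ℂ)) / (h : ℂ))
      * (Complex.exp ((f y / h : ℝ) : ℂ) * (-(h : ℂ) ^ 2 * ((((√(G y).det)⁻¹ : ℝ) : ℂ) *
        ∑ j, ∑ k, pderiv j (fun z ↦ ((√(G z).det * (G z)⁻¹ j k : ℝ) : ℂ) * pderiv k (fun z ↦
          Complex.exp ((-(f z) / h : ℝ) : ℂ)
            * Complex.exp (Complex.I * ((∑ j, z j * ξ j : ℝ) : ℂ) / (h : ℂ))) z) y))))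
      (𝓝[>] 0) (𝓝 (weightSymbol G f (y, ξ))) := by
  -- The weight and the plane wave combine into `exp (ψ / h)`, with `dψ = i (ξ + i df)`. Only the
  -- quadratic term in `dψ`, of order `h⁻²`, survives the factor `-h²` in the limit.
  set ψ : Coord n → ℂ := fun z ↦ Complex.I * ((∑ j, z j * ξ j : ℝ) : ℂ) - (f z : ℂ) with hψdef
  set A : Fin n → Fin n → Coord n → ℝ := fun j k z ↦ √(G z).det * (G z)⁻¹ j k with hAdef
  have hA : ∀ j k, ContDiffOn ℝ ∞ (A j k) U := fun j k ↦ hG.sqrt_det_smooth.mul (hG.inv_smooth j k)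
  have hlin : HasFDerivAt (fun z : Coord n ↦ Complex.I * ((∑ j, z j * ξ j : ℝ) : ℂ))
      (Complex.I • Complex.ofRealCLM.comp (∑ j, ξ j • (EuclideanSpace.proj j : Coord n →L[ℝ] ℝ)))
      y := by
    refine HasFDerivAt.const_mul ?_ _
    have := (Complex.ofRealCLM.comp
      (∑ j, ξ j • (EuclideanSpace.proj j : Coord n →L[ℝ] ℝ))).hasFDerivAt (x := y)
    refine this.congr_of_eventuallyEq (Eventually.of_forall fun z ↦ ?_)
    simp [mul_comm]
  have hψ : ContDiffOn ℝ ∞ ψ U := by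
    refine ContDiffOn.sub ?_ (Complex.ofRealCLM.contDiff.comp_contDiffOn hf)
    have hsum : ContDiff ℝ ∞ fun z : Coord n ↦ ∑ j, z j * ξ j :=
      ContDiff.sum fun j _ ↦ ContDiff.mul
        (EuclideanSpace.proj j : Coord n →L[ℝ] ℝ).contDiff contDiff_const
    exact (contDiff_const.mul (Complex.ofRealCLM.contDiff.comp hsum)).contDiffOn
  have hpψ : ∀ k, pderiv k ψ y = Complex.I * (ξ k + Complex.I * (pderiv k f y : ℝ)) := by
    intro k
    have hfd : DifferentiableAt ℝ f y :=
      (hf.contDiffAt (hG.isOpen.mem_nhds hy)).differentiableAt (by simp)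
    have : HasFDerivAt ψ _ y :=
      hlin.sub (Complex.ofRealCLM.hasFDerivAt.comp y hfd.hasFDerivAt)
    rw [pderiv, this.fderiv]
    simp [pderiv, stdVec, mul_add, ← mul_assoc, sub_eq_add_neg]
  have hprod : ∀ (h : ℝ) (z : Coord n), Complex.exp ((-(f z) / h : ℝ) : ℂ)
      * Complex.exp (Complex.I * ((∑ j, z j * ξ j : ℝ) : ℂ) / (h : ℂ)) = Complex.exp (ψ z / h) := by
    intro h z
    rw [← Complex.exp_add, hψdef]
    congr 1
    push_cast
    ring
  simp only [hprod]
  -- The lower order term: it enters with `1 / h`, hence with `h` after multiplication by `h²`.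
  set C : ℂ := ∑ j, ∑ k, pderiv j (fun z ↦ (A j k z : ℂ) * pderiv k ψ z) y with hC
  have hdet : ((√(G y).det : ℝ) : ℂ) ≠ 0 := by
    exact_mod_cast (Real.sqrt_pos.2 (hG.det_pos hy)).ne'
  have hsym : ∑ j, ∑ k, (A j k y : ℂ) * (pderiv j ψ y * pderiv k ψ y)
      = -((√(G y).det : ℝ) : ℂ) * weightSymbol G f (y, ξ) := by
    simp only [hpψ, weightSymbol, Finset.mul_sum, hAdef]
    refine Finset.sum_congr rfl fun j _ ↦ Finset.sum_congr rfl fun k _ ↦ ?_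
    push_cast
    linear_combination ((√(G y).det : ℝ) : ℂ) * ((G y)⁻¹ j k : ℝ)
      * (ξ j + Complex.I * (pderiv j f y : ℝ)) * (ξ k + Complex.I * (pderiv k f y : ℝ))
      * Complex.I_sq
  have hlim : Tendsto (fun h : ℝ ↦ weightSymbol G f (y, ξ)
      - (h : ℂ) * ((((√(G y).det)⁻¹ : ℝ) : ℂ) * C)) (𝓝[>] 0) (𝓝 (weightSymbol G f (y, ξ))) := by
    have hcont : Continuous fun h : ℝ ↦ weightSymbol G f (y, ξ)
      - (h : ℂ) * ((((√(G y).det)⁻¹ : ℝ) : ℂ) * C) := by fun_prop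
    have := hcont.tendsto 0
    simp only [Complex.ofReal_zero, zero_mul, sub_zero] at this
    exact this.mono_left nhdsWithin_le_nhds
  refine hlim.congr' ?_
  filter_upwards [self_mem_nhdsWithin] with h hh
  have hh0 : (h : ℂ) ≠ 0 := by exact_mod_cast (Set.mem_Ioi.1 hh).ne'
  have hsum := sum_pderiv_mul_pderiv_cexp hG.isOpen hA hψ hy h
  rw [hsym, ← hC] at hsum
  rw [hsum]
  have hcancel : Complex.exp (-(Complex.I * ((∑ j, y j * ξ j : ℝ) : ℂ)) / (h : ℂ))
      * (Complex.exp ((f y / h : ℝ) : ℂ) * Complex.exp (ψ y / h)) = 1 := by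
    rw [← Complex.exp_add, ← Complex.exp_add, Complex.exp_eq_one_iff]
    refine ⟨0, ?_⟩
    rw [hψdef]
    push_cast
    ring
  set E₁ := Complex.exp (-(Complex.I * ((∑ j, y j * ξ j : ℝ) : ℂ)) / (h : ℂ))
  set E₂ := Complex.exp ((f y / h : ℝ) : ℂ)
  set E₃ := Complex.exp (ψ y / h)
  have : (((√(G y).det)⁻¹ : ℝ) : ℂ) * ((√(G y).det : ℝ) : ℂ) = 1 := by
    push_cast
    exact inv_mul_cancel₀ hdet
  set a := (((√(G y).det)⁻¹ : ℝ) : ℂ)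
  set b := ((√(G y).det : ℝ) : ℂ)
  set W := weightSymbol G f (y, ξ)
  calc W - h * (a * C) = (E₁ * (E₂ * E₃)) * ((a * b) * W - h * (a * C)) := by rw [hcancel, this]; ring
    _ = _ := by field_simp; ring

end Calculus

/-! ### Vector fields in charts -/

section Charts

variable {n : ℕ} {M : Type*} [TopologicalSpace M] [ChartedSpace (Coord n) M]
  [IsManifold (𝓡 n) ∞ M] {e : OpenPartialHomeomorph M (Coord n)} {y : Coord n}

omit [IsManifold (𝓡 n) ∞ M] in
lemma mdifferentiable_of_mem_maximalAtlas (he : e ∈ IsManifold.maximalAtlas (𝓡 n) ∞ M) :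
    e.MDifferentiable (𝓡 n) (𝓡 n) :=
  ⟨(contMDiffOn_of_mem_maximalAtlas he).mdifferentiableOn (by simp),
    (contMDiffOn_symm_of_mem_maximalAtlas he).mdifferentiableOn (by simp)⟩

omit [IsManifold (𝓡 n) ∞ M] in
lemma mfderiv_apply_mfderiv_symm (he : e ∈ IsManifold.maximalAtlas (𝓡 n) ∞ M) (hy : y ∈ e.target)
    (v : TangentSpace (𝓡 n) y) :
    mfderiv (𝓡 n) (𝓡 n) e (e.symm y) (mfderiv (𝓡 n) (𝓡 n) e.symm y v) = v :=
  congr($((mdifferentiable_of_mem_maximalAtlas he).comp_symm_deriv hy) v)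

omit [IsManifold (𝓡 n) ∞ M] in
lemma mfderiv_symm_apply_mfderiv (he : e ∈ IsManifold.maximalAtlas (𝓡 n) ∞ M) {x : M}
    (hx : x ∈ e.source) (v : TangentSpace (𝓡 n) x) :
    mfderiv (𝓡 n) (𝓡 n) e.symm (e x) (mfderiv (𝓡 n) (𝓡 n) e x v) = v :=
  congr($((mdifferentiable_of_mem_maximalAtlas he).symm_comp_deriv hx) v)

omit [IsManifold (𝓡 n) ∞ M] in
/-- A tangent vector is a combination of the coordinate vectors. -/
lemma tangent_eq_sum_smul_coordVec (he : e ∈ IsManifold.maximalAtlas (𝓡 n) ∞ M) (hy : y ∈ e.target)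
    (w : TangentSpace (𝓡 n) (e.symm y)) :
    w = ∑ k, (EuclideanSpace.proj k : Coord n →L[ℝ] ℝ) (mfderiv (𝓡 n) (𝓡 n) e (e.symm y) w)
      • coordVec e k y := by
  have h := mfderiv_symm_apply_mfderiv he (e.map_target hy) w
  rw [e.right_inv hy] at h
  conv_lhs => rw [← h]
  exact clm_apply_eq_sum_stdVec (F := Coord n) (mfderiv (𝓡 n) (𝓡 n) e.symm y) _

omit [IsManifold (𝓡 n) ∞ M] in
lemma eq_sum_smul_coordVec (he : e ∈ IsManifold.maximalAtlas (𝓡 n) ∞ M) (hy : y ∈ e.target)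
    (X : (x : M) → TangentSpace (𝓡 n) x) :
    X (e.symm y) = ∑ k, component e X k y • coordVec e k y :=
  tangent_eq_sum_smul_coordVec he hy (X (e.symm y))

/-- The coordinate field is the image of a constant field under the tangent map of `e.symm`. -/
lemma contMDiffOn_coordVec (he : e ∈ IsManifold.maximalAtlas (𝓡 n) ∞ M) (j : Fin n) :
    ContMDiffOn (𝓡 n) (𝓡 n).tangent ∞
      (fun y ↦ (⟨e.symm y, coordVec e j y⟩ : TangentBundle (𝓡 n) M)) e.target := by
  have h1 := (contMDiffOn_symm_of_mem_maximalAtlas he).contMDiffOn_tangentMapWithin (m := ∞)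
    (by simp) e.open_target.uniqueMDiffOn
  have h2 : ContMDiffOn (𝓡 n) (𝓡 n).tangent ∞
      (fun y : Coord n ↦ (⟨y, stdVec j⟩ : TangentBundle (𝓡 n) (Coord n))) e.target :=
    contMDiffOn_vectorSpace_iff_contDiffOn.2 contDiffOn_const
  refine (h1.comp h2 fun y hy ↦ hy).congr fun y hy ↦ ?_
  simp only [Function.comp, tangentMapWithin, coordVec]
  rw [mfderivWithin_of_isOpen e.open_target hy]

lemma contDiffOn_component (he : e ∈ IsManifold.maximalAtlas (𝓡 n) ∞ M)
    {X : (x : M) → TangentSpace (𝓡 n) x}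
    (hX : ContMDiff (𝓡 n) (𝓡 n).tangent ∞ (fun x ↦ (⟨x, X x⟩ : TangentBundle (𝓡 n) M)))
    (k : Fin n) : ContDiffOn ℝ ∞ (component e X k) e.target := by
  have h1 := (contMDiffOn_of_mem_maximalAtlas he).contMDiffOn_tangentMapWithin (m := ∞)
    (by simp) e.open_source.uniqueMDiffOn
  have h2 : ContMDiffOn (𝓡 n) (𝓡 n).tangent ∞
      (fun y : Coord n ↦ (⟨e.symm y, X (e.symm y)⟩ : TangentBundle (𝓡 n) M)) e.target :=
    hX.comp_contMDiffOn (contMDiffOn_symm_of_mem_maximalAtlas he)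
  have h3 : ContMDiffOn (𝓡 n) (𝓡 n).tangent ∞ (fun y : Coord n ↦
      (⟨y, mfderiv (𝓡 n) (𝓡 n) e (e.symm y) (X (e.symm y))⟩ : TangentBundle (𝓡 n) (Coord n)))
      e.target := by
    refine (h1.comp h2 fun y hy ↦ e.map_target hy).congr fun y hy ↦ ?_
    simp only [Function.comp, tangentMapWithin]
    rw [mfderivWithin_of_isOpen e.open_source (e.map_target hy), e.right_inv hy]
  have h4 := contMDiffOn_vectorSpace_iff_contDiffOn.1 h3
  exact (EuclideanSpace.proj k : Coord n →L[ℝ] ℝ).contDiff.comp_contDiffOn h4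

/-- A vector field with smooth components is smooth. -/
lemma contMDiff_of_contDiffOn_component {X : (x : M) → TangentSpace (𝓡 n) x}
    (hX : ∀ e ∈ IsManifold.maximalAtlas (𝓡 n) ∞ M, ∀ k, ContDiffOn ℝ ∞ (component e X k) e.target) :
    ContMDiff (𝓡 n) (𝓡 n).tangent ∞ (fun x ↦ (⟨x, X x⟩ : TangentBundle (𝓡 n) M)) := by
  intro x₀
  set e := chartAt (Coord n) x₀ with he
  have hmem : e ∈ IsManifold.maximalAtlas (𝓡 n) ∞ M := IsManifold.chart_mem_maximalAtlas x₀
  rw [contMDiffAt_section]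
  have hsmooth : ContDiffOn ℝ ∞
      (fun y ↦ (WithLp.toLp 2 (fun k ↦ component e X k y) : Coord n)) e.target := by
    rw [contDiffOn_euclidean]
    exact fun k ↦ hX e hmem k
  have hcomp : ContMDiffAt (𝓡 n) (𝓡 n) ∞
      (fun x ↦ (WithLp.toLp 2 (fun k ↦ component e X k (e x)) : Coord n)) x₀ :=
    (hsmooth.contMDiffOn.contMDiffAt (e.open_target.mem_nhds (mem_chart_target _ x₀))).comp x₀
      (contMDiffAt_of_mem_maximalAtlas hmem (mem_chart_source _ x₀))
  refine hcomp.congr_of_eventuallyEq ?_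
  filter_upwards [e.open_source.mem_nhds (mem_chart_source _ x₀)] with x hx
  -- The trivialization of the tangent bundle at `x₀` is the differential of the chart at `x₀`, so
  -- it reads off the components of `X`.
  have h := congr($(TangentBundle.continuousLinearMapAt_trivializationAt (I := 𝓡 n) (𝕜 := ℝ)
    (x₀ := x₀) hx) (X x))
  rw [Trivialization.continuousLinearMapAt_apply, Trivialization.linearMapAt_apply,
    if_pos (by simpa using hx)] at h
  refine h.trans ?_
  ext k
  simp only [component]
  rw [e.left_inv hx]
  rfl

end Charts

/-! ### The metric and differentials in charts -/

section Metric

variable {n : ℕ} {M : Type*} [TopologicalSpace M] [ChartedSpace (Coord n) M]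
  [IsManifold (𝓡 n) ∞ M] {e : OpenPartialHomeomorph M (Coord n)} {y : Coord n}

lemma RiemMetric.contMDiffOn_inner (g : RiemMetric n M) {N : Type*} {EN HN : Type*}
    [NormedAddCommGroup EN] [NormedSpace ℝ EN] [TopologicalSpace HN]
    {I : ModelWithCorners ℝ EN HN} [TopologicalSpace N] [ChartedSpace HN N] {s : Set N}
    {b : N → M} {v w : (x : N) → TangentSpace (𝓡 n) (b x)}
    (hv : ContMDiffOn I (𝓡 n).tangent ∞ (fun x ↦ (⟨b x, v x⟩ : TangentBundle (𝓡 n) M)) s)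
    (hw : ContMDiffOn I (𝓡 n).tangent ∞ (fun x ↦ (⟨b x, w x⟩ : TangentBundle (𝓡 n) M)) s) :
    ContMDiffOn I 𝓘(ℝ, ℝ) ∞ (fun x ↦ g.inner (b x) (v x) (w x)) s := by
  let : RiemannianBundle (fun x : M ↦ TangentSpace (𝓡 n) x) := ⟨g.toRiemannianMetric⟩
  exact ContMDiffOn.inner_bundle (E := fun x : M ↦ TangentSpace (𝓡 n) x) hv hw

lemma isSmoothMetricOn_metricMatrix (g : RiemMetric n M)
    (he : e ∈ IsManifold.maximalAtlas (𝓡 n) ∞ M) : IsSmoothMetricOn (metricMatrix g e) e.target where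
  isOpen := e.open_target
  smooth j k := (g.contMDiffOn_inner (contMDiffOn_coordVec he j)
    (contMDiffOn_coordVec he k)).contDiffOn
  posDef y hy := by
    refine Matrix.PosDef.of_dotProduct_mulVec_pos ?_ fun v hv ↦ ?_
    · ext j k
      simpa [metricMatrix] using g.symm _ _ _
    · have h := g.pos (e.symm y) (∑ j, v j • coordVec e j y) ?_
      · simp only [map_sum, map_smul, _root_.sum_apply, _root_.smul_apply, smul_eq_mul] at h
        simp only [star_trivial, metricMatrix, dotProduct, Matrix.mulVec, Matrix.of_apply,
          Finset.mul_sum] at h ⊢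
        refine h.trans_eq (Finset.sum_congr rfl fun j _ ↦ Finset.sum_congr rfl fun k _ ↦ ?_)
        rw [g.symm]
        ring
      -- The differential of `e.symm` is injective, so a combination of coordinate vectors vanishes
      -- only if its coefficients do.
      · intro h0
        apply hv
        have h1 : mfderiv (𝓡 n) (𝓡 n) e.symm y (WithLp.toLp 2 v : Coord n) = 0 := by
          rw [← h0]
          exact clm_apply_eq_sum_stdVec (F := Coord n) (mfderiv (𝓡 n) (𝓡 n) e.symm y) _
        have h2 := mfderiv_apply_mfderiv_symm he hy (WithLp.toLp 2 v : Coord n)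
        rw [h1, map_zero] at h2
        exact ((WithLp.toLp_eq_zero 2).1 h2.symm)

omit [IsManifold (𝓡 n) ∞ M] in
lemma contDiffOn_comp_symm (he : e ∈ IsManifold.maximalAtlas (𝓡 n) ∞ M) {φ : M → ℝ}
    (hφ : ContMDiff (𝓡 n) 𝓘(ℝ, ℝ) ∞ φ) : ContDiffOn ℝ ∞ (φ ∘ e.symm) e.target :=
  (hφ.comp_contMDiffOn (contMDiffOn_symm_of_mem_maximalAtlas he)).contDiffOn

omit [IsManifold (𝓡 n) ∞ M] in
lemma pderiv_comp_symm (he : e ∈ IsManifold.maximalAtlas (𝓡 n) ∞ M) {φ : M → ℝ}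
    (hφ : MDifferentiableAt (𝓡 n) 𝓘(ℝ, ℝ) φ (e.symm y)) (hy : y ∈ e.target) (j : Fin n) :
    pderiv j (φ ∘ e.symm) y = mfderiv (𝓡 n) 𝓘(ℝ, ℝ) φ (e.symm y) (coordVec e j y) := by
  have := mfderiv_comp y hφ ((mdifferentiable_of_mem_maximalAtlas he).mdifferentiableAt_symm hy)
  rw [mfderiv_eq_fderiv] at this
  rw [pderiv, this]
  rfl

end Metric

/-! ### Conformal metrics, gradients and limiting Carleman weights -/

section Metric

variable {n : ℕ} {M : Type*} [TopologicalSpace M] [ChartedSpace (Coord n) M]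
  [IsManifold (𝓡 n) ∞ M] {e : OpenPartialHomeomorph M (Coord n)} {y : Coord n}

/-- The conformal multiple `c g` of a metric. -/
noncomputable def RiemMetric.conformal (g : RiemMetric n M) (c : M → ℝ)
    (hc : ContMDiff (𝓡 n) 𝓘(ℝ, ℝ) ∞ c) (hpos : ∀ x, 0 < c x) : RiemMetric n M where
  inner x := c x • g.inner x
  symm x v w := by
    simp [g.symm x v w]
  pos x v hv := by
    simpa using mul_pos (hpos x) (g.pos x v hv)
  isVonNBounded x := by
    -- The unit ball of `c g` is contained in the unit ball of `g` scaled by `c^{-1/2}`.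
    have h := (g.isVonNBounded x).image
      ((√(c x))⁻¹ • ContinuousLinearMap.id ℝ (TangentSpace (𝓡 n) x))
    refine h.subset fun v hv ↦ ?_
    have hs : 0 < √(c x) := Real.sqrt_pos.2 (hpos x)
    refine ⟨√(c x) • v, ?_, by simp [smul_smul, hs.ne']⟩
    have hv' : c x * g.inner x v v < 1 := by simpa using hv
    simpa [← mul_assoc, Real.mul_self_sqrt (hpos x).le] using hv'
  contMDiff := hc.smul_section (F := Coord n →L[ℝ] Coord n →L[ℝ] ℝ)
    (V := fun x : M ↦ TangentSpace (𝓡 n) x →L[ℝ] TangentSpace (𝓡 n) x →L[ℝ] ℝ) g.contMDiff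

/-- Positivity makes `v ↦ g(v, ·)` injective, and it is onto the dual space by equality of
dimensions. -/
lemma RiemMetric.exists_gradient (g : RiemMetric n M) (φ : M → ℝ) (x : M) :
    ∃ X : TangentSpace (𝓡 n) x, ∀ v : TangentSpace (𝓡 n) x,
      g.inner x X v = mfderiv (𝓡 n) 𝓘(ℝ, ℝ) φ x v := by
  have : FiniteDimensional ℝ (TangentSpace (𝓡 n) x) :=
    inferInstanceAs (FiniteDimensional ℝ (Coord n))
  let B : TangentSpace (𝓡 n) x →ₗ[ℝ] Module.Dual ℝ (TangentSpace (𝓡 n) x) :=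
    { toFun := fun v ↦ (g.inner x v : TangentSpace (𝓡 n) x →ₗ[ℝ] ℝ)
      map_add' := fun v w ↦ by ext; simp
      map_smul' := fun c v ↦ by ext; simp }
  have hinj : Function.Injective B := by
    rw [injective_iff_map_eq_zero]
    intro v hv
    by_contra hne
    have h1 := g.pos x v hne
    have h2 : g.inner x v v = 0 := congr($hv v)
    exact h1.ne' h2
  have hsurj : Function.Surjective B :=
    (LinearMap.injective_iff_surjective_of_finrank_eq_finrank Subspace.dual_finrank_eq.symm).1 hinj
  obtain ⟨X, hX⟩ := hsurj (mfderiv (𝓡 n) 𝓘(ℝ, ℝ) φ x).toLinearMap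
  exact ⟨X, fun v ↦ congr($hX v)⟩

lemma sum_metricMatrix_mul_component (g : RiemMetric n M)
    (he : e ∈ IsManifold.maximalAtlas (𝓡 n) ∞ M) (hy : y ∈ e.target)
    (X : (x : M) → TangentSpace (𝓡 n) x) (m : Fin n) :
    ∑ l, metricMatrix g e y m l * component e X l y
      = g.inner (e.symm y) (X (e.symm y)) (coordVec e m y) := by
  rw [g.symm, eq_sum_smul_coordVec he hy X]
  simp [metricMatrix, mul_comm]

/-- The components of the gradient vector field. -/
lemma component_eq_gradComponent (g : RiemMetric n M)
    (he : e ∈ IsManifold.maximalAtlas (𝓡 n) ∞ M) {X : (x : M) → TangentSpace (𝓡 n) x}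
    {φ : M → ℝ} (hφ : ContMDiff (𝓡 n) 𝓘(ℝ, ℝ) ∞ φ)
    (hX : ∀ x v, g.inner x (X x) v = mfderiv (𝓡 n) 𝓘(ℝ, ℝ) φ x v) (hy : y ∈ e.target) (l : Fin n) :
    component e X l y = gradComponent (metricMatrix g e) (φ ∘ e.symm) y l := by
  rw [← (isSmoothMetricOn_metricMatrix g he).sum_inv_mul_sum hy (fun l ↦ component e X l y) l,
    gradComponent]
  refine Finset.sum_congr rfl fun k _ ↦ ?_
  rw [sum_metricMatrix_mul_component g he hy, hX,
    pderiv_comp_symm he (hφ.mdifferentiable (by simp) _) hy]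

lemma contMDiff_gradient (g : RiemMetric n M) {X : (x : M) → TangentSpace (𝓡 n) x}
    {φ : M → ℝ} (hφ : ContMDiff (𝓡 n) 𝓘(ℝ, ℝ) ∞ φ)
    (hX : ∀ x v, g.inner x (X x) v = mfderiv (𝓡 n) 𝓘(ℝ, ℝ) φ x v) :
    ContMDiff (𝓡 n) (𝓡 n).tangent ∞ (fun x ↦ (⟨x, X x⟩ : TangentBundle (𝓡 n) M)) := by
  refine contMDiff_of_contDiffOn_component fun e he k ↦ ?_
  refine ContDiffOn.congr ?_ fun y hy ↦ component_eq_gradComponent g he hφ hX hy k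
  exact ContDiffOn.sum fun l _ ↦ ((isSmoothMetricOn_metricMatrix g he).inv_smooth k l).mul
    ((contDiffOn_comp_symm he hφ).pderiv e.open_target l)

lemma covDeriv_eq_covDerivComponent_grad (g : RiemMetric n M)
    (he : e ∈ IsManifold.maximalAtlas (𝓡 n) ∞ M) {X : (x : M) → TangentSpace (𝓡 n) x}
    {φ : M → ℝ} (hφ : ContMDiff (𝓡 n) 𝓘(ℝ, ℝ) ∞ φ)
    (hX : ∀ x v, g.inner x (X x) v = mfderiv (𝓡 n) 𝓘(ℝ, ℝ) φ x v) (hy : y ∈ e.target)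
    (j l : Fin n) :
    covDeriv g e X j l y = covDerivComponent (metricMatrix g e)
      (fun l z ↦ gradComponent (metricMatrix g e) (φ ∘ e.symm) z l) j l y := by
  have h := fun k z (hz : z ∈ e.target) ↦ component_eq_gradComponent g he hφ hX hz k
  have hrfl : covDeriv g e X j l y
      = covDerivComponent (metricMatrix g e) (component e X) j l y := rfl
  rw [hrfl, covDerivComponent, covDerivComponent, pderiv_congr_of_eqOn e.open_target (h l) hy]
  congr 1
  exact Finset.sum_congr rfl fun k _ ↦ by rw [h k y hy]

/-- Both sides are `dφ(X)`. This turns `|X| = 1` into the normalization used by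
`hessianComponent_eq_zero`. -/
lemma sum_gradComponent_mul_pderiv (g : RiemMetric n M)
    (he : e ∈ IsManifold.maximalAtlas (𝓡 n) ∞ M) {X : (x : M) → TangentSpace (𝓡 n) x}
    {φ : M → ℝ} (hφ : ContMDiff (𝓡 n) 𝓘(ℝ, ℝ) ∞ φ)
    (hX : ∀ x v, g.inner x (X x) v = mfderiv (𝓡 n) 𝓘(ℝ, ℝ) φ x v) (hy : y ∈ e.target) :
    ∑ j, gradComponent (metricMatrix g e) (φ ∘ e.symm) y j * pderiv j (φ ∘ e.symm) y
      = g.inner (e.symm y) (X (e.symm y)) (X (e.symm y)) := by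
  rw [hX]
  conv_rhs => rw [eq_sum_smul_coordVec he hy X]
  rw [map_sum]
  refine Finset.sum_congr rfl fun j _ ↦ ?_
  rw [map_smul, ← pderiv_comp_symm he (hφ.mdifferentiable (by simp) _) hy,
    component_eq_gradComponent g he hφ hX hy]
  rfl

lemma isPrincipalSymbol_weightSymbol (g : RiemMetric n M)
    (he : e ∈ IsManifold.maximalAtlas (𝓡 n) ∞ M) {φ : M → ℝ}
    (hφ : ContMDiff (𝓡 n) 𝓘(ℝ, ℝ) ∞ φ) :
    IsPrincipalSymbol (conjugatedOperator g e φ) e.target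
      (weightSymbol (metricMatrix g e) (φ ∘ e.symm)) := fun _ hy ξ ↦
  tendsto_conjugated_laplace (isSmoothMetricOn_metricMatrix g he) (contDiffOn_comp_symm he hφ) hy ξ

/-- Limits are unique, so the unspecified symbol in the definition of a limiting Carleman weight can
be replaced by `weightSymbol`; as `e.target` is open, the brackets agree too. -/
lemma IsPrincipalSymbol.eqOn {P : ℝ → (Coord n → ℂ) → Coord n → ℂ} {U : Set (Coord n)}
    {p q : Coord n × Coord n → ℂ} (hp : IsPrincipalSymbol P U p) (hq : IsPrincipalSymbol P U q) :
    Set.EqOn p q (U ×ˢ Set.univ) :=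
  fun ⟨y, ξ⟩ h ↦ tendsto_nhds_unique (hp y h.1 ξ) (hq y h.1 ξ)

lemma IsLimitingCarlemanWeight.poissonBracket_weightSymbol_eq_zero {g : RiemMetric n M} {φ : M → ℝ}
    (hφ : IsLimitingCarlemanWeight g φ) (he : e ∈ IsManifold.maximalAtlas (𝓡 n) ∞ M)
    (hy : y ∈ e.target) (ξ : Coord n)
    (h0 : weightSymbol (metricMatrix g e) (φ ∘ e.symm) (y, ξ) = 0) :
    poissonBracket (fun z ↦ conj (weightSymbol (metricMatrix g e) (φ ∘ e.symm) z))
      (weightSymbol (metricMatrix g e) (φ ∘ e.symm)) (y, ξ) = 0 := by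
  obtain ⟨p, hp, hbr⟩ := hφ.bracket e he
  have heq := hp.eqOn (isPrincipalSymbol_weightSymbol g he hφ.smooth)
  have hmem : (y, ξ) ∈ e.target ×ˢ (Set.univ : Set (Coord n)) := ⟨hy, trivial⟩
  have hev := heq.eventuallyEq_of_mem ((e.open_target.prod isOpen_univ).mem_nhds hmem)
  have h := hbr y hy ξ ((heq hmem).trans h0)
  exact (poissonBracket_congr (hev.fun_comp conj) hev).symm.trans h

lemma metricMatrix_eq_smul {g g₁ : RiemMetric n M} {c : M → ℝ}
    (h : ∀ (x : M) (v w : TangentSpace (𝓡 n) x), g₁.inner x v w = c x * g.inner x v w) :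
    metricMatrix g₁ e = fun y ↦ (c ∘ e.symm) y • metricMatrix g e y := by
  ext y j k
  simp [metricMatrix, h]

/-- A limiting Carleman weight has a parallel gradient for a conformal metric. -/
theorem exists_parallel_of_limitingCarlemanWeight (g : RiemMetric n M) {φ : M → ℝ}
    (hφ : IsLimitingCarlemanWeight g φ) :
    ∃ (g₁ : RiemMetric n M) (X : (x : M) → TangentSpace (𝓡 n) x),
      IsConformalMultiple g₁ g ∧ IsParallelUnitField g₁ X := by
  choose X₀ hX₀ using g.exists_gradient φ
  have hX₀s := contMDiff_gradient g hφ.smooth hX₀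
  have hX₀0 : ∀ x, X₀ x ≠ 0 := by
    intro x h0
    apply hφ.nonvanishing x
    ext v
    rw [← hX₀, h0]
    simp
    rfl
  -- The conformal factor `|dφ|²_g` gives `dφ` length 1 for `c g`.
  set c : M → ℝ := fun x ↦ g.inner x (X₀ x) (X₀ x) with hc
  have hcpos : ∀ x, 0 < c x := fun x ↦ g.pos x _ (hX₀0 x)
  have hcs : ContMDiff (𝓡 n) 𝓘(ℝ, ℝ) ∞ c := by
    rw [← contMDiffOn_univ]
    exact g.contMDiffOn_inner (b := id) hX₀s.contMDiffOn hX₀s.contMDiffOn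
  set g₁ := g.conformal c hcs hcpos with hg₁def
  have hg₁ : ∀ (x : M) (v w : TangentSpace (𝓡 n) x), g₁.inner x v w = c x * g.inner x v w :=
    fun x v w ↦ rfl
  -- The gradient of `φ` for `c g` is `c⁻¹` times the one for `g`.
  set X : (x : M) → TangentSpace (𝓡 n) x := fun x ↦ (c x)⁻¹ • X₀ x with hXdef
  have hX : ∀ x v, g₁.inner x (X x) v = mfderiv (𝓡 n) 𝓘(ℝ, ℝ) φ x v := by
    intro x v
    rw [hg₁, ← hX₀, hXdef]
    simp [mul_inv_cancel_left₀ (hcpos x).ne']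
  have hunit : ∀ x, g₁.inner x (X x) (X x) = 1 := by
    intro x
    rw [hX, ← hX₀, hXdef]
    simp only [map_smul, smul_eq_mul]
    exact inv_mul_cancel₀ (hcpos x).ne'
  refine ⟨g₁, X, ⟨c, hcs, hcpos, hg₁⟩, contMDiff_gradient g₁ hφ.smooth hX, hunit, ?_⟩
  intro e he y hy
  have hG₁ := isSmoothMetricOn_metricMatrix g₁ he
  have hf := contDiffOn_comp_symm he hφ.smooth
  have hhess : ∀ j m, hessianComponent (metricMatrix g₁ e) (φ ∘ e.symm) y j m = 0 := by
    refine hessianComponent_eq_zero hG₁ hf (fun z hz ↦ ?_) hy ?_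
    · rw [sum_gradComponent_mul_pderiv g₁ he hφ.smooth hX hz, hunit]
    · rw [metricMatrix_eq_smul hg₁]
      exact (bracket_condition_smul_iff (isSmoothMetricOn_metricMatrix g he) hf
        (contDiffOn_comp_symm he hcs) (fun z _ ↦ hcpos _) hy).2
        fun ξ ↦ hφ.poissonBracket_weightSymbol_eq_zero he hy ξ
  intro j l
  rw [covDeriv_eq_covDerivComponent_grad g₁ he hφ.smooth hX hy]
  exact (covDerivComponent_grad_eq_zero_iff hG₁ hf hy).2 hhess j l

/-- A potential of a parallel unit vector field of a conformal metric is a limiting Carleman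
weight. -/
theorem isLimitingCarlemanWeight_of_parallel {g g₁ : RiemMetric n M} (hg : IsConformalMultiple g₁ g)
    {X : (x : M) → TangentSpace (𝓡 n) x} (hXp : IsParallelUnitField g₁ X) {φ : M → ℝ}
    (hφ : ContMDiff (𝓡 n) 𝓘(ℝ, ℝ) ∞ φ)
    (hX : ∀ x v, g₁.inner x (X x) v = mfderiv (𝓡 n) 𝓘(ℝ, ℝ) φ x v) :
    IsLimitingCarlemanWeight g φ := by
  obtain ⟨c, hcs, hcpos, hc⟩ := hg
  refine ⟨hφ, fun x h0 ↦ ?_, fun e he ↦ ⟨_, isPrincipalSymbol_weightSymbol g he hφ, ?_⟩⟩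
  -- Unit length means `dφ(X) = 1`.
  · have := hXp.unit x
    rw [hX, h0] at this
    exact zero_ne_one (α := ℝ) this
  · intro y hy
    have hG₁ := isSmoothMetricOn_metricMatrix g₁ he
    have hf := contDiffOn_comp_symm he hφ
    have hhess := (covDerivComponent_grad_eq_zero_iff hG₁ hf hy).1 fun j l ↦ by
      rw [← covDeriv_eq_covDerivComponent_grad g₁ he hφ hX hy]
      exact hXp.parallel e he y hy j l
    refine (bracket_condition_smul_iff (isSmoothMetricOn_metricMatrix g he) hf
        (contDiffOn_comp_symm he hcs) (fun z _ ↦ hcpos _) hy).1 ?_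
    rw [← metricMatrix_eq_smul hc]
    intro ξ _
    rw [poissonBracket_weightSymbol hG₁ hf hy]
    simp [hhess]

end Metric

/-! ### Closed 1-forms on simply connected manifolds -/

section Potential

/-- The fiber bundle with discrete fiber of the local primitives `f i + const`. -/
def primitiveBundle {ι B : Type*} [TopologicalSpace B] (U : ι → Set B) (hU : ∀ i, IsOpen (U i))
    (ind : B → ι) (hind : ∀ x, x ∈ U (ind x)) (f : ι → B → ℝ)
    (hf : ∀ i j, ∀ z ∈ U i ∩ U j, ∀ᶠ w in 𝓝 z, f i w - f j w = f i z - f j z)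
    {F : Type*} [TopologicalSpace F] [DiscreteTopology F] (σ : F ≃ ℝ) : FiberBundleCore ι B F where
  baseSet := U
  isOpen_baseSet := hU
  indexAt := ind
  mem_baseSet_at := hind
  -- The coordinate `t` in chart `i` stands for the primitive whose value at `x` is `f i x + t`; a
  -- change of chart preserves this value. Continuity holds since the fiber is discrete and `f i - f
  -- j` is locally constant.
  coordChange i j x t := σ.symm (σ t + (f i x - f j x))
  coordChange_self i x _ v := by simp
  continuousOn_coordChange i j := by
    rintro ⟨x, t⟩ ⟨hx, -⟩
    refine ContinuousAt.continuousWithinAt ?_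
    have h1 : ∀ᶠ p : B × F in 𝓝 (x, t), f i p.1 - f j p.1 = f i x - f j x :=
      continuousAt_fst.eventually (p := fun w ↦ f i w - f j w = f i x - f j x) (hf i j x hx)
    have h2 : ∀ᶠ p : B × F in 𝓝 (x, t), p.2 = t := by
      have : ∀ᶠ s in 𝓝 t, s = t := by simp [nhds_discrete]
      exact continuousAt_snd.eventually (p := fun s ↦ s = t) this
    refine continuousAt_const.congr_of_eventuallyEq
      (f := fun _ ↦ σ.symm (σ t + (f i x - f j x))) ?_
    filter_upwards [h1, h2] with p hp1 hp2
    rw [hp1, hp2]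
  coordChange_comp i j k x _ v := by
    simp only [Equiv.apply_symm_apply]
    congr 1
    ring

/-- On a simply connected space, local primitives that differ by locally constant functions can be
glued, up to locally constant functions. -/
theorem exists_global_primitive {B : Type*} [TopologicalSpace B] [SimplyConnectedSpace B]
    [LocallyPathConnectedSpace B] (U : B → Set B) (hU : ∀ x, IsOpen (U x)) (hmem : ∀ x, x ∈ U x)
    (f : B → B → ℝ)
    (hf : ∀ i j, ∀ z ∈ U i ∩ U j, ∀ᶠ w in 𝓝 z, f i w - f j w = f i z - f j z) :
    ∃ φ : B → ℝ, ∀ x, ∀ᶠ w in 𝓝 x, φ w - f x w = φ x - f x x := by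
  -- A copy of `ℝ` that carries the discrete topology.
  let F : Type := ℝ
  let : TopologicalSpace F := ⊥
  have : DiscreteTopology F := ⟨rfl⟩
  let σ : F ≃ ℝ := Equiv.refl ℝ
  let Z := primitiveBundle U hU id hmem f hf σ
  have hcov : IsCoveringMap (π F Z.Fiber) := FiberBundle.isCoveringMap
  obtain ⟨a₀⟩ : Nonempty B := inferInstance
  -- The identity of the simply connected base lifts through the covering; the lift is a global
  -- section, that is, a coherent choice of local primitives.
  obtain ⟨s, ⟨-, hs⟩, -⟩ := hcov.existsUnique_continuousMap_lifts (ContinuousMap.id B) a₀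
    (⟨a₀, σ.symm 0⟩ : TotalSpace F Z.Fiber) rfl
  have hproj : ∀ x, (s x).proj = x := fun x ↦ congr_fun hs x
  let φ : B → ℝ := fun x ↦ σ (s x).2 + f (s x).proj x
  have hφ : ∀ i, ∀ w ∈ U i, φ w = σ (Z.localTriv i (s w)).2 + f i w := by
    intro i w hw
    have h1 : (Z.localTriv i (s w)).2 = σ.symm (σ (s w).2 + (f (s w).proj (s w).proj - f i (s w).proj)) :=
      rfl
    rw [h1, hproj w, Equiv.apply_symm_apply]
    simp only [φ]
    rw [hproj w]
    ring
  refine ⟨φ, fun x ↦ ?_⟩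
  have hcont : ContinuousAt (fun w ↦ (Z.localTriv x (s w)).2) x := by
    have h1 : ContinuousAt (Z.localTriv x) (s x) := by
      refine (Z.localTriv x).continuousAt ?_
      rw [(Z.localTriv x).mem_source]
      change (s x).proj ∈ U x
      rw [hproj]
      exact hmem x
    exact continuousAt_snd.comp (ContinuousAt.comp (f := s) h1 s.continuous.continuousAt)
  -- A continuous map into a discrete space is locally constant.
  have hev : ∀ᶠ w in 𝓝 x, (Z.localTriv x (s w)).2 = (Z.localTriv x (s x)).2 :=
    hcont.eventually (p := fun t ↦ t = (Z.localTriv x (s x)).2) (by simp [nhds_discrete])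
  filter_upwards [hev, (hU x).mem_nhds (hmem x)] with w hw hwU
  rw [hφ x w hwU, hφ x x (hmem x), hw]
  ring

variable {n : ℕ} {M : Type*} [TopologicalSpace M] [ChartedSpace (Coord n) M]
  [IsManifold (𝓡 n) ∞ M]

/-- A closed smooth 1-form on an open convex subset of `ℝⁿ` has a smooth primitive. -/
lemma exists_contDiffOn_primitive {V : Set (Coord n)} (hV : IsOpen V) (hconv : Convex ℝ V)
    {a : Fin n → Coord n → ℝ} (ha : ∀ m, ContDiffOn ℝ ∞ (a m) V)
    (hclosed : ∀ y ∈ V, ∀ j m, pderiv j (a m) y = pderiv m (a j) y) :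
    ∃ f : Coord n → ℝ, ContDiffOn ℝ ∞ f V ∧ ∀ y ∈ V, ∀ m, pderiv m f y = a m y := by
  set η : Coord n → Coord n →L[ℝ] ℝ := fun y ↦
    ∑ m, a m y • (EuclideanSpace.proj m : Coord n →L[ℝ] ℝ) with hη
  have hηs : ContDiffOn ℝ ∞ η V := ContDiffOn.sum fun m _ ↦ (ha m).smul contDiffOn_const
  have had : ∀ m, ∀ y ∈ V, DifferentiableAt ℝ (a m) y := fun m y hy ↦
    ((ha m).contDiffAt (hV.mem_nhds hy)).differentiableAt (by simp)
  have hfd : ∀ y ∈ V, ∀ u v, fderiv ℝ η y u v = ∑ j, ∑ m, u j * v m * pderiv j (a m) y := by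
    intro y hy u v
    have hd : HasFDerivAt η _ y := HasFDerivAt.fun_sum fun m _ ↦
      (had m y hy).hasFDerivAt.smul_const (EuclideanSpace.proj m : Coord n →L[ℝ] ℝ)
    rw [hd.fderiv, Finset.sum_comm]
    simp only [_root_.sum_apply]
    refine Finset.sum_congr rfl fun m _ ↦ ?_
    simp only [ContinuousLinearMap.smulRight_apply, _root_.smul_apply, smul_eq_mul]
    rw [clm_apply_eq_sum_stdVec (fderiv ℝ (a m) y) u, Finset.sum_mul]
    refine Finset.sum_congr rfl fun j _ ↦ ?_
    simp [pderiv]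
    ring
  -- Poincaré lemma: closedness is symmetry of the derivative of `η`.
  obtain ⟨f, hf⟩ := hconv.exists_forall_hasFDerivAt_of_fderiv_symmetric hV
    (hηs.differentiableOn (by simp)) (fun y hy u v ↦ by
      rw [hfd y hy, hfd y hy, Finset.sum_comm]
      refine Finset.sum_congr rfl fun j _ ↦ Finset.sum_congr rfl fun m _ ↦ ?_
      rw [hclosed y hy]
      ring)
  refine ⟨f, ?_, fun y hy m ↦ ?_⟩
  · rw [contDiffOn_infty_iff_fderiv_of_isOpen hV]
    exact ⟨fun y hy ↦ (hf y hy).differentiableAt.differentiableWithinAt,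
      hηs.congr fun y hy ↦ (hf y hy).fderiv⟩
  · rw [pderiv, (hf y hy).fderiv, hη]
    simp [stdVec]

/-- Local potentials of a closed 1-form `α`, given by its coordinates. -/
lemma exists_local_primitive {α : (x : M) → TangentSpace (𝓡 n) x →L[ℝ] ℝ}
    (hα : ∀ e ∈ IsManifold.maximalAtlas (𝓡 n) ∞ M, ∀ m,
      ContDiffOn ℝ ∞ (fun y ↦ α (e.symm y) (coordVec e m y)) e.target)
    (hclosed : ∀ e ∈ IsManifold.maximalAtlas (𝓡 n) ∞ M, ∀ y ∈ e.target, ∀ j m,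
      pderiv j (fun y ↦ α (e.symm y) (coordVec e m y)) y
        = pderiv m (fun y ↦ α (e.symm y) (coordVec e j y)) y) (x₀ : M) :
    ∃ (U : Set M) (f : M → ℝ), IsOpen U ∧ x₀ ∈ U ∧ ContMDiffOn (𝓡 n) 𝓘(ℝ, ℝ) ∞ f U ∧
      ∀ x ∈ U, ∀ v, mfderiv (𝓡 n) 𝓘(ℝ, ℝ) f x v = α x v := by
  set e := chartAt (Coord n) x₀ with hedef
  have he : e ∈ IsManifold.maximalAtlas (𝓡 n) ∞ M := IsManifold.chart_mem_maximalAtlas x₀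
  -- A ball inside the chart provides the convex domain for the Poincaré lemma.
  obtain ⟨r, hr, hball⟩ := Metric.isOpen_iff.1 e.open_target (e x₀) (mem_chart_target _ x₀)
  obtain ⟨f, hfs, hf⟩ := exists_contDiffOn_primitive Metric.isOpen_ball (convex_ball (e x₀) r)
    (fun m ↦ (hα e he m).mono hball) (fun y hy j m ↦ hclosed e he y (hball hy) j m)
  have hUo : IsOpen (e.source ∩ e ⁻¹' Metric.ball (e x₀) r) :=
    e.isOpen_inter_preimage Metric.isOpen_ball
  have hfe : ContMDiffOn (𝓡 n) 𝓘(ℝ, ℝ) ∞ (f ∘ e) (e.source ∩ e ⁻¹' Metric.ball (e x₀) r) :=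
    hfs.contMDiffOn.comp ((contMDiffOn_of_mem_maximalAtlas he).mono Set.inter_subset_left)
      fun x hx ↦ hx.2
  refine ⟨_, f ∘ e, hUo, ⟨mem_chart_source _ x₀, Metric.mem_ball_self hr⟩, hfe, ?_⟩
  intro x hx v
  have hxt := e.map_source hx.1
  have hmd : MDifferentiableAt (𝓡 n) 𝓘(ℝ, ℝ) (f ∘ e) (e.symm (e x)) := by
    rw [e.left_inv hx.1]
    exact (hfe.contMDiffAt (hUo.mem_nhds hx)).mdifferentiableAt (by simp)
  have hcoord : ∀ m, mfderiv (𝓡 n) 𝓘(ℝ, ℝ) (f ∘ e) (e.symm (e x)) (coordVec e m (e x))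
      = α (e.symm (e x)) (coordVec e m (e x)) := by
    intro m
    have h : pderiv m ((f ∘ e) ∘ e.symm) (e x) = pderiv m f (e x) :=
      pderiv_congr_of_eqOn e.open_target (fun z hz ↦ by simp [e.right_inv hz]) hxt m
    exact (pderiv_comp_symm he hmd hxt m).symm.trans (h.trans (hf (e x) hx.2 m))
  have hall : ∀ w : TangentSpace (𝓡 n) (e.symm (e x)),
      mfderiv (𝓡 n) 𝓘(ℝ, ℝ) (f ∘ e) (e.symm (e x)) w = α (e.symm (e x)) w := by
    intro w
    rw [tangent_eq_sum_smul_coordVec he hxt w]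
    simp only [map_sum, map_smul, hcoord]
    rfl
  rw [e.left_inv hx.1] at hall
  exact hall v

/-- A function whose differential vanishes near a point is locally constant. -/
lemma eventually_eq_of_mfderiv_eq_zero {h : M → ℝ} {V : Set M} (hV : IsOpen V)
    (hh : ContMDiffOn (𝓡 n) 𝓘(ℝ, ℝ) ∞ h V)
    (h0 : ∀ x ∈ V, ∀ v, mfderiv (𝓡 n) 𝓘(ℝ, ℝ) h x v = 0) {x₀ : M} (hx₀ : x₀ ∈ V) :
    ∀ᶠ x in 𝓝 x₀, h x = h x₀ := by
  set e := chartAt (Coord n) x₀ with hedef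
  have he : e ∈ IsManifold.maximalAtlas (𝓡 n) ∞ M := IsManifold.chart_mem_maximalAtlas x₀
  have hW : IsOpen (e.target ∩ e.symm ⁻¹' V) := e.isOpen_inter_preimage_symm hV
  have hmem : e x₀ ∈ e.target ∩ e.symm ⁻¹' V :=
    ⟨mem_chart_target _ x₀, by simpa [hedef] using hx₀⟩
  obtain ⟨r, hr, hball⟩ := Metric.isOpen_iff.1 hW (e x₀) hmem
  have hmd : ∀ z ∈ Metric.ball (e x₀) r, MDifferentiableAt (𝓡 n) 𝓘(ℝ, ℝ) h (e.symm z) :=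
    fun z hz ↦ (hh.contMDiffAt (hV.mem_nhds (hball hz).2)).mdifferentiableAt (by simp)
  have hsm : ContDiffOn ℝ ∞ (h ∘ e.symm) (e.target ∩ e.symm ⁻¹' V) :=
    (hh.comp ((contMDiffOn_symm_of_mem_maximalAtlas he).mono Set.inter_subset_left)
      fun z hz ↦ hz.2).contDiffOn
  have hfd : ∀ z ∈ Metric.ball (e x₀) r, fderiv ℝ (h ∘ e.symm) z = 0 := by
    intro z hz
    ext v
    have hp : ∀ j, fderiv ℝ (h ∘ e.symm) z (stdVec j) = 0 := fun j ↦
      (pderiv_comp_symm he (hmd z hz) (hball hz).1 j).trans (h0 _ (hball hz).2 _)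
    rw [clm_apply_eq_sum_stdVec (fderiv ℝ (h ∘ e.symm) z) v]
    simp [hp]
  have hcont : ContinuousAt e x₀ := e.continuousAt (mem_chart_source _ x₀)
  filter_upwards [e.open_source.mem_nhds (mem_chart_source _ x₀),
    hcont.preimage_mem_nhds (Metric.ball_mem_nhds (e x₀) hr)] with x hxs hxb
  have := Metric.isOpen_ball.is_const_of_fderiv_eq_zero (convex_ball (e x₀) r).isPreconnected
    ((hsm.mono hball).differentiableOn (by simp)) hfd hxb (Metric.mem_ball_self hr)
  simpa [e.left_inv hxs, e.left_inv (mem_chart_source _ x₀)] using this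

/-- On a simply connected manifold, a closed smooth 1-form is exact. -/
theorem exists_primitive_of_closed [SimplyConnectedSpace M]
    {α : (x : M) → TangentSpace (𝓡 n) x →L[ℝ] ℝ}
    (hα : ∀ e ∈ IsManifold.maximalAtlas (𝓡 n) ∞ M, ∀ m,
      ContDiffOn ℝ ∞ (fun y ↦ α (e.symm y) (coordVec e m y)) e.target)
    (hclosed : ∀ e ∈ IsManifold.maximalAtlas (𝓡 n) ∞ M, ∀ y ∈ e.target, ∀ j m,
      pderiv j (fun y ↦ α (e.symm y) (coordVec e m y)) y
        = pderiv m (fun y ↦ α (e.symm y) (coordVec e j y)) y) :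
    ∃ φ : M → ℝ, ContMDiff (𝓡 n) 𝓘(ℝ, ℝ) ∞ φ ∧
      ∀ x v, mfderiv (𝓡 n) 𝓘(ℝ, ℝ) φ x v = α x v := by
  have : LocallyPathConnectedSpace M := ChartedSpace.locallyPathConnectedSpace (Coord n) M
  choose U f hU hmem hfs hf using exists_local_primitive hα hclosed
  -- Two local primitives have the same differential on the overlap.
  have hloc : ∀ i j, ∀ z ∈ U i ∩ U j, ∀ᶠ w in 𝓝 z, f i w - f j w = f i z - f j z := by
    intro i j z hz
    have hs := ((hfs i).mono Set.inter_subset_left).sub ((hfs j).mono Set.inter_subset_right)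
    refine eventually_eq_of_mfderiv_eq_zero (h := fun w ↦ f i w - f j w)
      ((hU i).inter (hU j)) hs (fun x hx v ↦ ?_) hz
    have h1 := ((hfs i).contMDiffAt ((hU i).mem_nhds hx.1)).mdifferentiableAt (by simp)
    have h2 := ((hfs j).contMDiffAt ((hU j).mem_nhds hx.2)).mdifferentiableAt (by simp)
    have h3 := congr($((h1.hasMFDerivAt.sub h2.hasMFDerivAt).mfderiv) v)
    refine h3.trans ?_
    exact sub_eq_zero.2 ((hf i x hx.1 v).trans (hf j x hx.2 v).symm)
  obtain ⟨φ, hφ⟩ := exists_global_primitive U hU hmem f hloc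
  have heq : ∀ x, φ =ᶠ[𝓝 x] fun w ↦ f x w + (φ x - f x x) := by
    intro x
    filter_upwards [hφ x] with w hw
    linarith
  refine ⟨φ, fun x ↦ ?_, fun x v ↦ ?_⟩
  · exact (((hfs x).contMDiffAt ((hU x).mem_nhds (hmem x))).add contMDiffAt_const).congr_of_eventuallyEq
      (heq x)
  · have h1 := ((hfs x).contMDiffAt ((hU x).mem_nhds (hmem x))).mdifferentiableAt (by simp)
    have h2 := h1.hasMFDerivAt.add (hasMFDerivAt_const (I := 𝓡 n) (I' := 𝓘(ℝ, ℝ)) (φ x - f x x) x)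
    have h3 := h2.congr_of_eventuallyEq (heq x)
    have h4 := congr($(h3.mfderiv) v)
    refine h4.trans ?_
    refine Eq.trans ?_ (hf x x (hmem x) v)
    exact add_zero _

/-- The 1-form dual to a parallel vector field is closed. -/
theorem exists_potential_of_parallel [SimplyConnectedSpace M] {g : RiemMetric n M}
    {X : (x : M) → TangentSpace (𝓡 n) x} (hX : IsParallelUnitField g X) :
    ∃ φ : M → ℝ, ContMDiff (𝓡 n) 𝓘(ℝ, ℝ) ∞ φ ∧
      ∀ x v, g.inner x (X x) v = mfderiv (𝓡 n) 𝓘(ℝ, ℝ) φ x v := by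
  have hcoord : ∀ e ∈ IsManifold.maximalAtlas (𝓡 n) ∞ M, ∀ m, Set.EqOn
      (fun y ↦ g.inner (e.symm y) (X (e.symm y)) (coordVec e m y))
      (fun y ↦ ∑ l, metricMatrix g e y m l * component e X l y) e.target :=
    fun e he m y hy ↦ (sum_metricMatrix_mul_component g he hy X m).symm
  have hclosed : ∀ e ∈ IsManifold.maximalAtlas (𝓡 n) ∞ M, ∀ y ∈ e.target, ∀ j m,
      pderiv j (fun y ↦ g.inner (e.symm y) (X (e.symm y)) (coordVec e m y)) y
        = pderiv m (fun y ↦ g.inner (e.symm y) (X (e.symm y)) (coordVec e j y)) y := by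
    intro e he y hy j m
    rw [pderiv_congr_of_eqOn e.open_target (hcoord e he m) hy,
      pderiv_congr_of_eqOn e.open_target (hcoord e he j) hy]
    have hG := isSmoothMetricOn_metricMatrix g he
    have hXd : ∀ l, DifferentiableAt ℝ (component e X l) y := fun l ↦
      ((contDiffOn_component he hX.smooth l).contDiffAt
        (e.open_target.mem_nhds hy)).differentiableAt (by simp)
    -- Lowering the index in `DX = 0` expresses `∂_j X_m` by Christoffel symbols, which are
    -- symmetric in `j` and `m`.
    have key : ∀ j m, pderiv j (fun z ↦ ∑ l, metricMatrix g e z m l * component e X l z) y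
        = (1 / 2) * ∑ k, (pderiv j (fun z ↦ metricMatrix g e z m k) y
          + pderiv m (fun z ↦ metricMatrix g e z j k) y
          - pderiv k (fun z ↦ metricMatrix g e z j m) y) * component e X k y := by
      intro j m
      rw [← sub_eq_zero, ← sum_mul_covDerivComponent hG hy hXd]
      refine Finset.sum_eq_zero fun l _ ↦ ?_
      have : covDerivComponent (metricMatrix g e) (component e X) j l y = 0 :=
        hX.parallel e he y hy j l
      rw [this, mul_zero]
    rw [key, key]
    congr 1
    refine Finset.sum_congr rfl fun k _ ↦ ?_
    rw [hG.pderiv_symm hy k j m]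
    ring
  obtain ⟨φ, hφ, hd⟩ := exists_primitive_of_closed (α := fun x ↦ g.inner x (X x))
    (fun e he m ↦ ContDiffOn.congr (ContDiffOn.sum fun l _ ↦
      ((isSmoothMetricOn_metricMatrix g he).smooth m l).mul (contDiffOn_component he hX.smooth l))
      (hcoord e he m)) hclosed
  exact ⟨φ, hφ, fun x v ↦ (hd x v).symm⟩

end Potential

/-! ### The two implications -/

theorem theorem1 {n : ℕ} {M : Type*} [TopologicalSpace M] [T2Space M]
    [SecondCountableTopology M] [ChartedSpace (Coord n) M] [IsManifold (𝓡 n) ∞ M]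
    (g : RiemMetric n M) :
    (IsOpenManifold M → (∃ φ : M → ℝ, IsLimitingCarlemanWeight g φ) →
      ∃ (g₁ : RiemMetric n M) (X : (x : M) → TangentSpace (𝓡 n) x),
        IsConformalMultiple g₁ g ∧ IsParallelUnitField g₁ X) ∧
    (SimplyConnectedSpace M →
      (∃ (g₁ : RiemMetric n M) (X : (x : M) → TangentSpace (𝓡 n) x),
        IsConformalMultiple g₁ g ∧ IsParallelUnitField g₁ X) →
      ∃ φ : M → ℝ, IsLimitingCarlemanWeight g φ) := by
  refine ⟨fun _ ⟨φ, hφ⟩ ↦ exists_parallel_of_limitingCarlemanWeight g hφ, ?_⟩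
  rintro _ ⟨g₁, X, hg, hX⟩
  obtain ⟨φ, hφ, hd⟩ := exists_potential_of_parallel hX
  exact ⟨φ, isLimitingCarlemanWeight_of_parallel hg hX hφ hd⟩
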